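/- Let $n\ge 2$ and let $\Omega\subset\mathbb R^n$ be open. For $x\in\Omega$ let $d(x,\partial\Omega)$ be the Euclidean distance from $x$ to $\partial\Omega$ ($=\infty$ if $\partial\Omega=\emptyset$). For $u\in C(\Omega)$ (real-valued continuous functions on $\Omega$), $p\ge 1$, $\delta\in(0,1)$ and $\tau>0$ put $$g_u^{\tau}(x)=\int_{\Omega\cap B(x,\tau d(x,\partial\Omega))}\frac{|u(x)-u(y)|^p}{|x-y|^{n+p\delta}}\,dy\in[0,\infty],\qquad x\in\Omega .$$ For a set $B$, write $B\subset\subset\Omega$ if $B\subset\Omega$ and $B$ has positive distance to $\partial\Omega$ (no condition on the distance if $\partial\Omega=\emptyset$). Call $A\subset\Omega$ admissible if $A$ is open and $\partial A\cap\Omega$ is a (possibly empty) smooth submanifold. For $f>0$ with $\int_\Omega f\,dx<\infty$ put $u_{\Omega,f}=\int_\Omega uf\,dx\big/\int_\Omega f\,dx$. Theorem 1.1. There is a constant $\tau_0>0$, depending only on $\Omega$, with the following property. Let $f,g$ be positive continuous functions on $\Omega$ with $\int_\Omega f\,dx<\infty$, and let $1\le p\le q<\infty$, $\delta\in(0,1)$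 and $\tau\in(0,\tau_0)$. Assume that for every open ball $B\subset\subset\Omega$ there is a constant $C=C(\Omega,B,f,g,p,q,\delta,\tau)$ such that $$\Big(\int_A f(x)\,dx\Big)^{p/q}\le C\,\inf_u\int_\Omega g_u^{\tau}(x)\,g(x)\,dx$$ for every admissible set $A\subset\Omega$ with $A\cap B=\emptyset$, where the infimum is over all $u\in C(\Omega)$ with $u\ge 1$ on $A$ and $u=0$ on $B$ (and is $\infty$ if there is no such $u$). Then there is a constant $C$, independent of $u$, such that for every $u\in C(\Omega)$ $$\Big(\int_\Omega|u(x)-u_{\Omega,f}|^q f(x)\,dx\Big)^{1/q}\le C\Big(\int_\Omega g_u^{\tau}(x)\,g(x)\,dx\Big)^{1/p},$$ where both sides may be infinite; if the right-hand side is finite, then $uf$ is integrable on $\Omega$, so that $u_{\Omega,f}$ is well defined. (If the right-hand side is infinite, the inequality holds trivially.) -/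

import Mathlib

open MeasureTheory Set
open scoped ENNReal ContDiff

noncomputable section

namespace FracSP

/-- `B ⊂⊂ Ω`: the set `B` is contained in `Ω` and has positive distance to `∂Ω`
(no condition on the distance if `∂Ω = ∅`). -/
def WellInside {n : ℕ} (B Ω : Set (EuclideanSpace ℝ (Fin n))) : Prop :=
  B ⊆ Ω ∧ ∃ ε : ℝ, 0 < ε ∧ ∀ x ∈ B, ∀ y ∈ frontier Ω, ε ≤ dist x y

/-- `S` is a (possibly empty) smooth embedded submanifold of `ℝⁿ`: for some codimension `m`,
near each of its points `S` is the zero set of a `C^∞` submersion into `ℝᵐ`. -/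
def IsSmoothSubmanifold {n : ℕ} (S : Set (EuclideanSpace ℝ (Fin n))) : Prop :=
  ∃ m : ℕ, ∀ x ∈ S, ∃ (U : Set (EuclideanSpace ℝ (Fin n)))
    (F : EuclideanSpace ℝ (Fin n) → EuclideanSpace ℝ (Fin m)),
    IsOpen U ∧ x ∈ U ∧ ContDiffOn ℝ ∞ F U ∧
    (∀ y ∈ U, Function.Surjective (fderiv ℝ F y)) ∧
    S ∩ U = {y ∈ U | F y = 0}

/-- Admissible subsets of `Ω`: open sets `A ⊆ Ω` for which `∂A ∩ Ω` is a smooth submanifold. -/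
def IsAdmissible {n : ℕ} (Ω A : Set (EuclideanSpace ℝ (Fin n))) : Prop :=
  A ⊆ Ω ∧ IsOpen A ∧ IsSmoothSubmanifold (frontier A ∩ Ω)

/-- The set `Ω ∩ B(x, τ d(x, ∂Ω))`. The distance is extended real valued, so that it is `∞`
(and the ball is the whole space) if `∂Ω = ∅`. -/
def localBall {n : ℕ} (Ω : Set (EuclideanSpace ℝ (Fin n))) (τ : ℝ)
    (x : EuclideanSpace ℝ (Fin n)) : Set (EuclideanSpace ℝ (Fin n)) :=
  Ω ∩ {y | edist y x < ENNReal.ofReal τ * Metric.infEDist x (frontier Ω)}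

/-- The function
`g_u^τ(x) = ∫_{Ω ∩ B(x, τ d(x, ∂Ω))} |u(x) - u(y)|^p / |x - y|^(n + p δ) dy ∈ [0, ∞]`. -/
def fracGrad {n : ℕ} (Ω : Set (EuclideanSpace ℝ (Fin n))) (p δ τ : ℝ)
    (u : EuclideanSpace ℝ (Fin n) → ℝ) (x : EuclideanSpace ℝ (Fin n)) : ℝ≥0∞ :=
  ∫⁻ y in localBall Ω τ x, ENNReal.ofReal (|u x - u y| ^ p / dist x y ^ ((n : ℝ) + p * δ))

/-- The weighted energy `∫_Ω g_u^τ(x) g(x) dx ∈ [0, ∞]`. -/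
def energy {n : ℕ} (Ω : Set (EuclideanSpace ℝ (Fin n))) (g : EuclideanSpace ℝ (Fin n) → ℝ)
    (p δ τ : ℝ) (u : EuclideanSpace ℝ (Fin n) → ℝ) : ℝ≥0∞ :=
  ∫⁻ x in Ω, fracGrad Ω p δ τ u x * ENNReal.ofReal (g x)

/-- The infimum of the weighted energy over all `u ∈ C(Ω)` with `u ≥ 1` on `A` and `u = 0`
on `B` (it is `∞` if there is no such `u`). -/
def capacity {n : ℕ} (Ω : Set (EuclideanSpace ℝ (Fin n))) (g : EuclideanSpace ℝ (Fin n) → ℝ)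
    (p δ τ : ℝ) (A B : Set (EuclideanSpace ℝ (Fin n))) : ℝ≥0∞ :=
  ⨅ (u : EuclideanSpace ℝ (Fin n) → ℝ) (_ : ContinuousOn u Ω)
    (_ : ∀ x ∈ A, 1 ≤ u x) (_ : ∀ x ∈ B, u x = 0), energy Ω g p δ τ u

/-- The weighted capacity estimate: for every ball `B ⊂⊂ Ω` there is a constant `C` such that
`(∫_A f)^(p/q) ≤ C cap(A, B)` for all admissible `A ⊆ Ω` with `A ∩ B = ∅`. -/
def CapacityEstimate {n : ℕ} (Ω : Set (EuclideanSpace ℝ (Fin n)))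
    (f g : EuclideanSpace ℝ (Fin n) → ℝ) (p q δ τ : ℝ) : Prop :=
  ∀ (z : EuclideanSpace ℝ (Fin n)) (r : ℝ), 0 < r → WellInside (Metric.ball z r) Ω →
    ∃ C : ℝ, 0 < C ∧ ∀ A : Set (EuclideanSpace ℝ (Fin n)),
      IsAdmissible Ω A → A ∩ Metric.ball z r = ∅ →
      (∫⁻ x in A, ENNReal.ofReal (f x)) ^ (p / q) ≤
        ENNReal.ofReal C * capacity Ω g p δ τ A (Metric.ball z r)

/-- The weighted average `u_{Ω,f} = ∫_Ω u f / ∫_Ω f`. -/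
def weightedAverage {n : ℕ} (Ω : Set (EuclideanSpace ℝ (Fin n)))
    (f u : EuclideanSpace ℝ (Fin n) → ℝ) : ℝ :=
  (∫ x in Ω, u x * f x) / ∫ x in Ω, f x

end FracSP

end

namespace FracSP

open Metric

/-! Fix a small ball B(z, r) in Ω, put S = B(z, 2r), let φ be the cutoff that is 0 on B(z, r) and 1
off S, and let c be the mean of u over S. Then v = φ(u - c) vanishes on B(z, r), and its energy is
at most a constant times that of u (`AnchorBall.exists_energy_cutoff_mul_le`). Maz'ya's truncation
(`lintegral_rpow_le_of_capacityEstimate`) applies the capacity estimate to the dyadic slices of |v|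
and sums. Since v = u - c off S, this bounds u - c in L^q(f dx) outside S.

The set S itself is recovered by using two such balls with disjoint doubles: each double lies where
the estimate of the other ball is valid, and the two constants are compared on a third ball that
avoids both (`exists_eLpNorm_sub_const_le`). Replacing the constant by the f-mean costs only a
factor, because f dx is a finite measure (`exists_eLpNorm_sub_average_le`).

The capacity estimate concerns admissible sets, while superlevel sets of a continuous function are
merely open. They are exhausted in measure by finite unions of balls with disjoint closures
(`exists_isAdmissible_lt_measure`). -/

/-! ### Admissible sets made of disjoint balls -/

theorem isSmoothSubmanifold_frontier_biUnion_ball {n : ℕ} {Ω : Set (EuclideanSpace ℝ (Fin n))}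
    (hΩ : IsOpen Ω) (t : Finset (EuclideanSpace ℝ (Fin n))) (r : EuclideanSpace ℝ (Fin n) → ℝ)
    (hr : ∀ x ∈ t, 0 < r x)
    (hd : (t : Set (EuclideanSpace ℝ (Fin n))).PairwiseDisjoint fun x => closedBall x (r x)) :
    IsSmoothSubmanifold (frontier (⋃ x ∈ t, ball x (r x)) ∩ Ω) := by
  classical
  set A := ⋃ x ∈ t, ball x (r x) with hA
  have hAo : IsOpen A := isOpen_biUnion fun _ _ => isOpen_ball
  have hcl : closure A = ⋃ x ∈ t, closedBall x (r x) := by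
    rw [hA, Finset.closure_biUnion]
    exact iUnion₂_congr fun x hx => closure_ball x (hr x hx).ne'
  have hfr : ∀ y, y ∈ frontier A ↔ y ∈ closure A ∧ y ∉ A := fun y => by
    rw [hAo.frontier_eq]; rfl
  refine ⟨1, fun x hx => ?_⟩
  obtain ⟨hxc, hxA⟩ := (hfr x).1 hx.1
  rw [hcl] at hxc
  obtain ⟨i, hi, hxi⟩ := mem_iUnion₂.1 hxc
  have hxi' : x ∉ ball i (r i) := fun h => hxA (mem_biUnion hi h)
  set b : EuclideanSpace ℝ (Fin 1) := EuclideanSpace.single 0 1 with hb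
  -- Disjointness of the closed balls lets the neighbourhood avoid all but the i-th, so only one
  -- sphere is seen. Removing the centre i keeps the gradient 2(y - i) of the defining function
  -- nonzero.
  refine ⟨(Ω ∩ {i}ᶜ) ∩ (⋃ j ∈ t.erase i, closedBall j (r j))ᶜ,
    fun y => (‖y - i‖ ^ 2 - r i ^ 2) • b, ?_, ?_, ?_, ?_, ?_⟩
  · refine (hΩ.inter isOpen_compl_singleton).inter ?_
    exact (Set.Finite.isClosed_biUnion (t.erase i).finite_toSet
      fun _ _ => isClosed_closedBall).isOpen_compl
  · refine ⟨⟨hx.2, ?_⟩, ?_⟩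
    · rintro rfl
      exact hxi' (mem_ball_self (hr _ hi))
    · simp only [mem_compl_iff, mem_iUnion, not_exists]
      intro j hj hxj
      exact Set.disjoint_left.1 (hd hi (Finset.mem_of_mem_erase hj)
        (Finset.ne_of_mem_erase hj).symm) hxi hxj
  · refine ContDiff.contDiffOn ?_
    exact ((((contDiff_id.sub contDiff_const).norm_sq ℝ).sub contDiff_const).smul contDiff_const)
  · rintro y ⟨⟨-, hyi⟩, -⟩ w
    have hne : y - i ≠ 0 := sub_ne_zero.2 hyi
    have hder : HasFDerivAt (fun y : EuclideanSpace ℝ (Fin n) => (‖y - i‖ ^ 2 - r i ^ 2) • b)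
        ((2 • (innerSL ℝ (y - i))).smulRight b) y := by
      have h1 : HasFDerivAt (fun y : EuclideanSpace ℝ (Fin n) => y - i)
        (ContinuousLinearMap.id ℝ _) y := (hasFDerivAt_id y).sub_const i
      have h2 := (h1.norm_sq.sub_const (r i ^ 2)).smul_const b
      simpa using h2
    rw [hder.fderiv]
    refine ⟨(w 0 / (2 * ‖y - i‖ ^ 2)) • (y - i), ?_⟩
    have hn : ‖y - i‖ ≠ 0 := norm_ne_zero_iff.2 hne
    ext k
    fin_cases k
    simp [hb]
    field_simp
    rw [← inner_sub_left, real_inner_self_eq_norm_sq]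
  · ext y
    constructor
    · rintro ⟨⟨hy, hyΩ⟩, hU⟩
      refine ⟨hU, ?_⟩
      obtain ⟨hyc, hyA⟩ := (hfr y).1 hy
      rw [hcl] at hyc
      obtain ⟨j, hj, hyj⟩ := mem_iUnion₂.1 hyc
      have hji : j = i := by
        by_contra hne
        exact hU.2 (mem_biUnion (Finset.mem_coe.2 (Finset.mem_erase.2 ⟨hne, hj⟩)) hyj)
      subst hji
      have h3 : ¬ dist y j < r j := fun h => hyA (mem_biUnion hj h)
      have h4 : ‖y - j‖ = r j := by
        rw [← dist_eq_norm]; exact le_antisymm hyj (not_lt.1 h3)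
      simp [h4]
    · rintro ⟨hU, hF⟩
      refine ⟨⟨(hfr y).2 ⟨?_, ?_⟩, hU.1.1⟩, hU⟩
      all_goals
        have hF' : ‖y - i‖ ^ 2 - r i ^ 2 = 0 := by
          rcases smul_eq_zero.1 hF with h | h
          · exact h
          · simp [hb] at h
        have h4 : dist y i = r i := by
          rw [dist_eq_norm]
          nlinarith [norm_nonneg (y - i), hr i hi]
      · rw [hcl]
        exact mem_biUnion (Finset.mem_coe.2 hi) h4.le
      · intro h
        obtain ⟨j, hj, hyj⟩ := mem_iUnion₂.1 h
        by_cases hji : j = i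
        · subst hji
          exact (mem_ball.1 hyj).ne h4
        · exact hU.2 (mem_biUnion (Finset.mem_coe.2 (Finset.mem_erase.2 ⟨hji, hj⟩))
            (ball_subset_closedBall hyj))

/-- An open subset of `Ω` is exhausted in measure by admissible sets. -/
theorem exists_isAdmissible_lt_measure {n : ℕ} {Ω U : Set (EuclideanSpace ℝ (Fin n))}
    (hΩ : IsOpen Ω) (hU : IsOpen U) (hUΩ : U ⊆ Ω) (hn : n ≠ 0)
    {ν : Measure (EuclideanSpace ℝ (Fin n))} (hν : ν ≪ volume) {a : ℝ≥0∞} (ha : a < ν U) :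
    ∃ A ⊆ U, IsAdmissible Ω A ∧ a < ν A := by
  classical
  have : Nonempty (Fin n) := ⟨⟨0, Nat.pos_of_ne_zero hn⟩⟩
  choose! ρ hρ0 hρ using fun x (hx : x ∈ U) => Metric.isOpen_iff.1 hU x hx
  obtain ⟨t, r, htc, htU, htr, ht0, htd⟩ := Besicovitch.exists_disjoint_closedBall_covering_ae
    (volume : Measure (EuclideanSpace ℝ (Fin n))) (fun _ => univ) U
    (fun x _ δ hδ => by simpa using hδ) ρ hρ0
  -- Spheres are null sets, so the closed balls of the covering theorem may be replaced by open
  -- ones.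
  have hball : ∀ x ∈ t, ν (closedBall x (r x)) = ν (ball x (r x)) := fun x _ => by
    refine measure_congr ?_
    refine hν.ae_eq ?_
    exact (ae_eq_set.2 ⟨by
      rw [closedBall_sdiff_ball]
      exact Measure.addHaar_sphere_of_ne_zero volume x (htr x ‹_›).2.1.ne', by
      rw [sdiff_eq_empty.2 ball_subset_closedBall]; simp⟩)
  have hle : ν U ≤ ∑' x : t, ν (ball (x : EuclideanSpace ℝ (Fin n)) (r x)) := by
    calc ν U ≤ ν (⋃ x ∈ t, closedBall x (r x)) := by
          refine measure_mono_ae ?_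
          exact ae_le_set.2 (hν ht0)
      _ ≤ ∑' x : t, ν (closedBall (x : EuclideanSpace ℝ (Fin n)) (r x)) :=
          measure_biUnion_le ν htc _
      _ = _ := by
          congr 1; ext x; exact hball x x.2
  have hlt := ha.trans_le hle
  -- Finitely many balls already have total measure above a; finiteness is what makes the frontier a
  -- union of spheres.
  rw [ENNReal.tsum_eq_iSup_sum, lt_iSup_iff] at hlt
  obtain ⟨s, hs⟩ := hlt
  set T : Finset (EuclideanSpace ℝ (Fin n)) := s.map (Function.Embedding.subtype _) with hT
  have hTt : ∀ x ∈ T, x ∈ t := by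
    intro x hx
    obtain ⟨y, -, rfl⟩ := Finset.mem_map.1 hx
    exact y.2
  have hdisj : (T : Set (EuclideanSpace ℝ (Fin n))).PairwiseDisjoint
      fun x => closedBall x (r x) := htd.subset hTt
  have hAU : ⋃ x ∈ T, ball x (r x) ⊆ U := iUnion₂_subset fun x hx =>
    (ball_subset_ball (htr x (hTt x hx)).2.2.le).trans (hρ x (htU (hTt x hx)))
  refine ⟨⋃ x ∈ T, ball x (r x), hAU, ⟨hAU.trans hUΩ,
    isOpen_biUnion fun _ _ => isOpen_ball,
    isSmoothSubmanifold_frontier_biUnion_ball hΩ T r (fun x hx => (htr x (hTt x hx)).2.1) hdisj⟩, ?_⟩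
  rw [measure_biUnion_finset (fun x hx y hy hxy =>
    (hdisj hx hy hxy).mono ball_subset_closedBall ball_subset_closedBall)
    fun _ _ => measurableSet_ball, hT, Finset.sum_map]
  exact hs

/-! ### The measure f dx and the capacity estimate for open sets -/

/-- The measure `f dx` on `Ω`. -/
noncomputable def weightMeasure {n : ℕ} (Ω : Set (EuclideanSpace ℝ (Fin n)))
    (f : EuclideanSpace ℝ (Fin n) → ℝ) : Measure (EuclideanSpace ℝ (Fin n)) :=
  (volume.restrict Ω).withDensity fun x => ENNReal.ofReal (f x)

theorem weightMeasure_absolutelyContinuous {n : ℕ} (Ω : Set (EuclideanSpace ℝ (Fin n)))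
    (f : EuclideanSpace ℝ (Fin n) → ℝ) : weightMeasure Ω f ≪ volume :=
  (withDensity_absolutelyContinuous _ _).trans Measure.absolutelyContinuous_restrict

theorem weightMeasure_apply {n : ℕ} {Ω A : Set (EuclideanSpace ℝ (Fin n))}
    (f : EuclideanSpace ℝ (Fin n) → ℝ) (hA : MeasurableSet A) (hAΩ : A ⊆ Ω) :
    weightMeasure Ω f A = ∫⁻ x in A, ENNReal.ofReal (f x) := by
  rw [weightMeasure, withDensity_apply _ hA, Measure.restrict_restrict hA,
    inter_eq_self_of_subset_left hAΩ]

theorem ae_weightMeasure_mem {n : ℕ} {Ω : Set (EuclideanSpace ℝ (Fin n))} (hΩ : IsOpen Ω)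
    (f : EuclideanSpace ℝ (Fin n) → ℝ) : ∀ᵐ x ∂weightMeasure Ω f, x ∈ Ω :=
  (withDensity_absolutelyContinuous _ _).ae_le (ae_restrict_mem hΩ.measurableSet)

/-- The capacity estimate passes from admissible sets to arbitrary open superlevel sets. -/
theorem weightMeasure_rpow_le_energy {n : ℕ} {Ω U B : Set (EuclideanSpace ℝ (Fin n))}
    {f g w : EuclideanSpace ℝ (Fin n) → ℝ} {p q δ τ : ℝ} {C : ℝ≥0∞}
    (hn : n ≠ 0) (hΩ : IsOpen Ω) (hp : 0 < p) (hq : 0 < q)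
    (hC : ∀ A, IsAdmissible Ω A → A ∩ B = ∅ →
      (∫⁻ x in A, ENNReal.ofReal (f x)) ^ (p / q) ≤ C * capacity Ω g p δ τ A B)
    (hU : IsOpen U) (hUΩ : U ⊆ Ω) (hw : ContinuousOn w Ω) (hwU : ∀ x ∈ U, 1 ≤ w x)
    (hwB : ∀ x ∈ B, w x = 0) :
    weightMeasure Ω f U ≤ (C * energy Ω g p δ τ w) ^ (q / p) := by
  refine le_of_forall_lt fun a ha => ?_
  obtain ⟨A, hAU, hA, haA⟩ := exists_isAdmissible_lt_measure hΩ hU hUΩ hn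
    (weightMeasure_absolutelyContinuous Ω f) ha
  refine haA.trans_le ?_
  rw [← inv_div p q, ENNReal.le_rpow_inv_iff (div_pos hp hq),
    weightMeasure_apply f hA.2.1.measurableSet hA.1]
  refine (hC A hA ?_).trans ?_
  · refine eq_empty_of_forall_notMem fun x hx => ?_
    have h1 := hwU x (hAU hx.1)
    rw [hwB x hx.2] at h1
    linarith
  · gcongr
    exact iInf₂_le_of_le w hw (iInf₂_le_of_le (fun x hx => hwU x (hAU hx)) hwB le_rfl)

/-! ### Dyadic truncation -/

theorem energy_const_mul {n : ℕ} (Ω : Set (EuclideanSpace ℝ (Fin n)))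
    (g w : EuclideanSpace ℝ (Fin n) → ℝ) (p δ τ a : ℝ) :
    energy Ω g p δ τ (fun x => a * w x) = ENNReal.ofReal (|a| ^ p) * energy Ω g p δ τ w := by
  unfold energy fracGrad
  rw [← lintegral_const_mul' _ _ ENNReal.ofReal_ne_top]
  congr 1; ext x
  rw [← mul_assoc, ← lintegral_const_mul' _ _ ENNReal.ofReal_ne_top]
  congr 2; ext y
  rw [← ENNReal.ofReal_mul (by positivity), ← mul_sub, abs_mul,
    Real.mul_rpow (abs_nonneg _) (abs_nonneg _), mul_div_assoc]

/-- The lower integral is superadditive without any measurability, so this applies to `fracGrad` as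
a function of x for arbitrary u. -/
theorem sum_lintegral_le {α ι : Type*} [MeasurableSpace α] (μ : Measure α) (s : Finset ι)
    (F : ι → α → ℝ≥0∞) : ∑ i ∈ s, ∫⁻ x, F i x ∂μ ≤ ∫⁻ x, ∑ i ∈ s, F i x ∂μ := by
  classical
  induction s using Finset.induction_on with
  | empty => simp
  | insert i s hi ih =>
    simp only [Finset.sum_insert hi]
    exact (add_le_add le_rfl ih).trans (le_lintegral_add _ _)

theorem tsum_energy_le {n : ℕ} {ι : Type*} (Ω : Set (EuclideanSpace ℝ (Fin n)))
    (g w : EuclideanSpace ℝ (Fin n) → ℝ) (h : ι → EuclideanSpace ℝ (Fin n) → ℝ) (p δ τ : ℝ)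
    (hle : ∀ (s : Finset ι) (x y : EuclideanSpace ℝ (Fin n)),
      ∑ i ∈ s, |h i x - h i y| ^ p ≤ |w x - w y| ^ p) :
    ∑' i, energy Ω g p δ τ (h i) ≤ energy Ω g p δ τ w := by
  refine ENNReal.summable.tsum_le_of_sum_le fun s => ?_
  unfold energy
  refine (sum_lintegral_le _ _ _).trans (lintegral_mono fun x => ?_)
  dsimp only
  rw [← Finset.sum_mul]
  gcongr
  unfold fracGrad
  refine (sum_lintegral_le _ _ _).trans (lintegral_mono fun y => ?_)
  dsimp only
  rw [← ENNReal.ofReal_sum_of_nonneg fun i _ => by positivity, ← Finset.sum_div]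
  gcongr
  exact hle s x y

theorem sum_rpow_le_rpow_sum {ι : Type*} (s : Finset ι) (a : ι → ℝ) (ha : ∀ i, 0 ≤ a i) {p : ℝ}
    (hp : 1 ≤ p) : ∑ i ∈ s, a i ^ p ≤ (∑ i ∈ s, a i) ^ p := by
  classical
  induction s using Finset.induction_on with
  | empty => simp [Real.zero_rpow (by linarith : p ≠ 0)]
  | insert i s hi ih =>
    rw [Finset.sum_insert hi, Finset.sum_insert hi]
    exact (add_le_add le_rfl ih).trans
      (Real.add_rpow_le_rpow_add (ha i) (Finset.sum_nonneg fun i _ => ha i) hp)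

theorem tsum_rpow_le_rpow_tsum {ι : Type*} (a : ι → ℝ≥0∞) {p : ℝ} (hp : 1 ≤ p) :
    ∑' i, a i ^ p ≤ (∑' i, a i) ^ p := by
  classical
  refine ENNReal.summable.tsum_le_of_sum_le fun s => ?_
  refine le_trans ?_ (ENNReal.rpow_le_rpow (ENNReal.sum_le_tsum s) (by linarith))
  induction s using Finset.induction_on with
  | empty => simp [ENNReal.zero_rpow_of_pos (by linarith : 0 < p)]
  | insert i s hi ih =>
    rw [Finset.sum_insert hi, Finset.sum_insert hi]
    exact (add_le_add le_rfl ih).trans (ENNReal.add_rpow_le_rpow_add _ _ hp)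

/-- The dyadic slice of `a` between the levels `2 ^ k` and `2 ^ (k + 1)`. -/
noncomputable def dyadicSlice (k : ℤ) (a : ℝ) : ℝ := min a (2 ^ (k + 1)) - min a (2 ^ k)

theorem dyadicSlice_of_le {k : ℤ} {a : ℝ} (h : (2 : ℝ) ^ (k + 1) ≤ a) :
    dyadicSlice k a = 2 ^ k := by
  have h2 : (2 : ℝ) ^ (k + 1) = 2 ^ k * 2 := zpow_add_one₀ two_ne_zero k
  have h3 : (0 : ℝ) < 2 ^ k := by positivity
  rw [dyadicSlice, min_eq_right h, min_eq_right (by linarith), h2]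
  ring

theorem dyadicSlice_zero (k : ℤ) : dyadicSlice k 0 = 0 := by
  simp [dyadicSlice, (zpow_pos (two_pos (α := ℝ)) _).le]

theorem continuous_dyadicSlice (k : ℤ) : Continuous (dyadicSlice k) := by
  unfold dyadicSlice; fun_prop

theorem min_sub_min_mono {a b c d : ℝ} (hba : b ≤ a) (hcd : c ≤ d) :
    min a c - min b c ≤ min a d - min b d := by
  rcases min_cases a c with h | h <;> rcases min_cases b c with h' | h' <;>
    rcases min_cases a d with h'' | h'' <;> rcases min_cases b d with h3 | h3 <;> linarith

theorem dyadicSlice_mono (k : ℤ) : Monotone (dyadicSlice k) := fun b a h => by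
  have := min_sub_min_mono h
    (zpow_le_zpow_right₀ (one_le_two (α := ℝ)) (by linarith : k ≤ k + 1))
  unfold dyadicSlice
  linarith

/-- Slices at consecutive levels telescope, and skipped levels only lose because each slice is
monotone. Removing the largest index k leaves a sum bounded by the increment of the truncation at
height 2^k. -/
theorem sum_dyadicSlice_sub_le {a b : ℝ} (hba : b ≤ a) (s : Finset ℤ) :
    ∑ k ∈ s, (dyadicSlice k a - dyadicSlice k b) ≤ a - b := by
  have key : ∀ M : ℤ, (∀ k ∈ s, k < M) →
      ∑ k ∈ s, (dyadicSlice k a - dyadicSlice k b) ≤ min a (2 ^ M) - min b (2 ^ M) := by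
    induction s using Finset.induction_on_max with
    | empty =>
      intro M _
      simpa using min_le_min_right _ hba
    | insert k s hk ih =>
      intro M hM
      rw [Finset.sum_insert fun h => (hk k h).false]
      have h1 := ih k hk
      have h2 : min a ((2 : ℝ) ^ (k + 1)) - min b (2 ^ (k + 1)) ≤ min a (2 ^ M) - min b (2 ^ M) :=
        min_sub_min_mono hba (zpow_le_zpow_right₀ one_le_two (hM k (Finset.mem_insert_self _ _)))
      unfold dyadicSlice at *
      linarith
  obtain ⟨M, hM⟩ := s.bddAbove
  refine (key (M + 1) fun k hk => Int.lt_add_one_of_le (hM hk)).trans ?_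
  rcases min_cases a ((2 : ℝ) ^ (M + 1)) with h | h <;>
    rcases min_cases b ((2 : ℝ) ^ (M + 1)) with h' | h' <;> linarith

/-- All slice increments have the same sign, so their absolute values add up to at most |a - b|; for
p ≥ 1 the p-th powers are then superadditive. -/
theorem sum_abs_dyadicSlice_sub_rpow_le (a b : ℝ) (s : Finset ℤ) {p : ℝ} (hp : 1 ≤ p) :
    ∑ k ∈ s, |dyadicSlice k a - dyadicSlice k b| ^ p ≤ |a - b| ^ p := by
  wlog hba : b ≤ a generalizing a b
  · simpa only [abs_sub_comm] using this b a (le_of_not_ge hba)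
  refine (sum_rpow_le_rpow_sum s _ (fun _ => abs_nonneg _) hp).trans ?_
  refine Real.rpow_le_rpow (Finset.sum_nonneg fun _ _ => abs_nonneg _) ?_ (by linarith)
  rw [abs_of_nonneg (sub_nonneg.2 hba)]
  refine le_trans (le_of_eq ?_) (sum_dyadicSlice_sub_le hba s)
  exact Finset.sum_congr rfl fun k _ =>
    abs_of_nonneg (sub_nonneg.2 (dyadicSlice_mono k hba))

/-- Maz'ya's truncation argument: the capacity estimate implies the weighted Sobolev inequality
for functions vanishing on `B`. -/
theorem lintegral_rpow_le_of_capacityEstimate {n : ℕ} {Ω B : Set (EuclideanSpace ℝ (Fin n))}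
    {f g v : EuclideanSpace ℝ (Fin n) → ℝ} {p q δ τ : ℝ} {C : ℝ≥0∞}
    (hn : n ≠ 0) (hΩ : IsOpen Ω) (hp : 1 ≤ p) (hpq : p ≤ q)
    (hC : ∀ A, IsAdmissible Ω A → A ∩ B = ∅ →
      (∫⁻ x in A, ENNReal.ofReal (f x)) ^ (p / q) ≤ C * capacity Ω g p δ τ A B)
    (hv : ContinuousOn v Ω) (hvB : ∀ x ∈ B, v x = 0) :
    ∫⁻ x, ENNReal.ofReal (|v x| ^ q) ∂weightMeasure Ω f ≤
      (ENNReal.ofReal (4 ^ p) * C * energy Ω g p δ τ v) ^ (q / p) := by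
  have hp0 : 0 < p := by linarith
  have hq0 : 0 < q := by linarith
  set U : ℤ → Set (EuclideanSpace ℝ (Fin n)) := fun k => Ω ∩ {x | (2 : ℝ) ^ (k + 1) < |v x|}
  have hUo : ∀ k, IsOpen (U k) := fun k => hv.abs.isOpen_inter_preimage hΩ isOpen_Ioi
  set h : ℤ → EuclideanSpace ℝ (Fin n) → ℝ := fun k x => dyadicSlice k |v x| with hh
  -- The test function for `U k` is 2^(-k) `h k`, which equals 1 there. The 4 is 2^(k+2) / 2^k.
  have hU : ∀ k, ENNReal.ofReal (((2 : ℝ) ^ (k + 2)) ^ q) * weightMeasure Ω f (U k) ≤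
      (ENNReal.ofReal (4 ^ p) * C * energy Ω g p δ τ (h k)) ^ (q / p) := by
    intro k
    have h2k : (0 : ℝ) < 2 ^ k := by positivity
    have h1 := weightMeasure_rpow_le_energy (w := fun x => (2 ^ k)⁻¹ * h k x) hn hΩ hp0 hq0 hC
      (hUo k) inter_subset_left
      (continuousOn_const.mul ((continuous_dyadicSlice k).comp_continuousOn hv.abs))
      (fun x hx => by
        simp only [hh]
        rw [dyadicSlice_of_le (le_of_lt hx.2), inv_mul_cancel₀ h2k.ne'])
      (fun x hx => by simp [hh, hvB x hx, dyadicSlice_zero])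
    rw [energy_const_mul] at h1
    refine (mul_le_mul_right h1 _).trans (le_of_eq ?_)
    have h3 : ENNReal.ofReal (((2 : ℝ) ^ (k + 2)) ^ q) =
        ENNReal.ofReal (((2 : ℝ) ^ (k + 2)) ^ p) ^ (q / p) := by
      rw [ENNReal.ofReal_rpow_of_nonneg (by positivity) (by positivity),
        ← Real.rpow_mul (by positivity), mul_div_cancel₀ _ hp0.ne']
    rw [h3, ← ENNReal.mul_rpow_of_nonneg _ _ (by positivity)]
    congr 1
    have h4 : ENNReal.ofReal ((4 : ℝ) ^ p) = ENNReal.ofReal (((2 : ℝ) ^ (k + 2)) ^ p) *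
        ENNReal.ofReal (|((2 : ℝ) ^ k)⁻¹| ^ p) := by
      rw [← ENNReal.ofReal_mul (by positivity), ← Real.mul_rpow (by positivity) (by positivity),
        abs_of_pos (by positivity), zpow_add₀ two_ne_zero]
      congr 2
      field_simp
      norm_num
    rw [h4]
    ring
  calc ∫⁻ x, ENNReal.ofReal (|v x| ^ q) ∂weightMeasure Ω f
      ≤ ∫⁻ x, ∑' k : ℤ, (U k).indicator
          (fun _ => ENNReal.ofReal (((2 : ℝ) ^ (k + 2)) ^ q)) x ∂weightMeasure Ω f := by
        refine lintegral_mono_ae ?_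
        filter_upwards [ae_weightMeasure_mem hΩ f] with x hx
        rcases (abs_nonneg (v x)).eq_or_lt with h0 | h0
        · simp [← h0, Real.zero_rpow hq0.ne']
        · obtain ⟨m, hm1, hm2⟩ := exists_mem_Ioc_zpow h0 (one_lt_two (α := ℝ))
          -- For 2^m < |v x| ≤ 2^(m+1) the single term k = m - 1 suffices: x lies in `U k` and
          -- 2^(k+2) = 2^(m+1).
          refine le_trans ?_ (ENNReal.le_tsum (m - 1))
          have hxU : x ∈ U (m - 1) := ⟨hx, by simpa using hm1⟩
          rw [indicator_of_mem hxU]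
          have : m - 1 + 2 = m + 1 := by ring
          rw [this]
          gcongr
    _ = ∑' k : ℤ, ENNReal.ofReal (((2 : ℝ) ^ (k + 2)) ^ q) * weightMeasure Ω f (U k) := by
        rw [lintegral_tsum fun k =>
          (measurable_const.indicator (hUo k).measurableSet).aemeasurable]
        congr 1; ext k
        rw [lintegral_indicator_const (hUo k).measurableSet]
    _ ≤ ∑' k : ℤ, (ENNReal.ofReal (4 ^ p) * C * energy Ω g p δ τ (h k)) ^ (q / p) :=
        ENNReal.tsum_le_tsum hU
    -- Here p ≤ q enters, through q / p ≥ 1.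
    _ ≤ (∑' k : ℤ, ENNReal.ofReal (4 ^ p) * C * energy Ω g p δ τ (h k)) ^ (q / p) :=
        tsum_rpow_le_rpow_tsum _ ((one_le_div hp0).2 hpq)
    _ ≤ _ := by
        rw [ENNReal.tsum_mul_left]
        gcongr
        refine tsum_energy_le _ _ _ _ _ _ _ fun s x y => ?_
        refine (sum_abs_dyadicSlice_sub_rpow_le _ _ s hp).trans ?_
        exact Real.rpow_le_rpow (abs_nonneg _) (abs_abs_sub_abs_le _ _) hp0.le

/-! ### Local balls and anchor balls -/

theorem mem_localBall_iff {n : ℕ} {Ω : Set (EuclideanSpace ℝ (Fin n))} {τ : ℝ}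
    {x y : EuclideanSpace ℝ (Fin n)} (hτ : 0 ≤ τ) (hF : (frontier Ω).Nonempty) :
    y ∈ localBall Ω τ x ↔ y ∈ Ω ∧ dist y x < τ * infDist x (frontier Ω) := by
  rw [localBall, mem_inter_iff, mem_ofPred_eq,
    ← ENNReal.ofReal_toReal (infEDist_ne_top hF), ← ENNReal.ofReal_mul hτ, edist_dist,
    ENNReal.ofReal_lt_ofReal_iff_of_nonneg dist_nonneg]
  rfl

theorem measurableSet_localBall {n : ℕ} {Ω : Set (EuclideanSpace ℝ (Fin n))} (hΩ : IsOpen Ω)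
    (τ : ℝ) (x : EuclideanSpace ℝ (Fin n)) : MeasurableSet (localBall Ω τ x) :=
  hΩ.measurableSet.inter (measurableSet_eball (x := x)
    (ε := ENNReal.ofReal τ * Metric.infEDist x (frontier Ω)))

/-- A ball whose double is contained in the local ball of every nearby point; local balls that
meet the double either contain it or are centred in a fixed compact subset of `Ω`. -/
structure AnchorBall {n : ℕ} (Ω : Set (EuclideanSpace ℝ (Fin n))) (τ : ℝ)
    (z : EuclideanSpace ℝ (Fin n)) (r : ℝ) (K : Set (EuclideanSpace ℝ (Fin n))) : Prop where
  pos : 0 < r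
  subset : closedBall z (3 * r) ⊆ Ω
  wellInside : WellInside (ball z r) Ω
  near : ∀ x ∈ ball z (3 * r), ball z (2 * r) ⊆ localBall Ω τ x
  compact : IsCompact K
  compact_subset : K ⊆ Ω
  far : ∀ x ∈ Ω, (localBall Ω τ x ∩ ball z (2 * r)).Nonempty →
    ball z (2 * r) ⊆ localBall Ω τ x ∨ x ∈ K

/-- The ball is connected, meets Ω and misses the frontier. -/
theorem ball_infDist_frontier_subset {n : ℕ} {Ω : Set (EuclideanSpace ℝ (Fin n))}
    (hΩ : IsOpen Ω) {z : EuclideanSpace ℝ (Fin n)} (hz : z ∈ Ω) :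
    ball z (infDist z (frontier Ω)) ⊆ Ω := by
  rcases (infDist_nonneg (x := z) (s := frontier Ω)).eq_or_lt with h | h
  · simp [← h]
  refine (convex_ball z _).isPreconnected.subset_left_of_subset_union hΩ
    isClosed_closure.isOpen_compl (disjoint_compl_right.mono_left subset_closure) ?_
    ⟨z, mem_ball_self h, hz⟩
  intro y hy
  by_cases hyΩ : y ∈ Ω
  · exact Or.inl hyΩ
  · refine Or.inr fun hyc => Set.disjoint_left.1 disjoint_ball_infDist hy ?_
    rw [hΩ.frontier_eq]
    exact ⟨hyc, hyΩ⟩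

/-- If ∂Ω = ∅, every local ball is the whole space and K = ∅ works. Otherwise a local ball that
reaches B(z, 2r) has its centre in a fixed closed ball about z, which serves as K. -/
theorem exists_anchorBall {n : ℕ} {Ω : Set (EuclideanSpace ℝ (Fin n))} (hΩ : IsOpen Ω)
    {τ : ℝ} (hτ : 0 < τ) (hτ4 : τ < 1 / 4) {z : EuclideanSpace ℝ (Fin n)} (hz : z ∈ Ω) :
    ∃ r₀ > 0, ∀ r, 0 < r → r ≤ r₀ → ∃ K, AnchorBall Ω τ z r K := by
  rcases (frontier Ω).eq_empty_or_nonempty with hF | hF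
  · have hu : Ω = univ := by
      rcases frontier_eq_empty_iff.1 hF with h | h
      · simp [h] at hz
      · exact h
    have hloc : ∀ x, localBall Ω τ x = univ := fun x => by
      refine eq_univ_of_forall fun y => ⟨hu ▸ mem_univ y, ?_⟩
      have : ENNReal.ofReal τ ≠ 0 := by simpa using hτ
      simp [hF, ENNReal.mul_top this, edist_lt_top]
    refine ⟨1, one_pos, fun r hr _ => ⟨∅, hr, ?_, ⟨?_, 1, one_pos, ?_⟩, ?_, isCompact_empty,
      empty_subset _, ?_⟩⟩
    · simp [hu]
    · simp [hu]
    · simp [hF]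
    · simp [hloc]
    · simp [hloc]
  · set d := infDist z (frontier Ω) with hd
    have hd0 : 0 < d := by
      refine (isClosed_frontier.notMem_iff_infDist_pos hF).1 fun h => ?_
      rw [hΩ.frontier_eq] at h
      exact h.2 hz
    have hball := ball_infDist_frontier_subset hΩ hz
    -- Points of B(z, 3r) stay at distance at least d / 2 from ∂Ω, so their local radius is at least
    -- τd / 2 ≥ 5r, and 5r exceeds their distance to any point of B(z, 2r).
    refine ⟨τ * d / 10, by positivity, fun r hr hrd => ?_⟩
    have hτd : τ * d < d / 4 := by nlinarith
    refine ⟨closedBall z (d / 2), hr, ?_, ⟨?_, d / 2, by positivity, ?_⟩, ?_,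
      isCompact_closedBall _ _, (closedBall_subset_ball (by linarith)).trans hball, ?_⟩
    · exact (closedBall_subset_ball (by linarith)).trans hball
    · exact (ball_subset_ball (by linarith)).trans hball
    · intro x hx y hy
      have h1 : d ≤ dist z y := infDist_le_dist_of_mem hy
      have h2 := dist_triangle z x y
      rw [mem_ball, dist_comm] at hx
      linarith
    · intro x hx y hy
      rw [mem_localBall_iff hτ.le hF]
      refine ⟨hball (ball_subset_ball (by linarith) hy), ?_⟩
      have h1 : d ≤ infDist x (frontier Ω) + dist z x := infDist_le_infDist_add_dist
      have h2 := dist_triangle y z x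
      rw [mem_ball] at hx hy
      rw [dist_comm z x] at h1 h2
      have h3 : d / 2 ≤ infDist x (frontier Ω) := by linarith
      nlinarith
    · rintro x hx ⟨y, hy, hyz⟩
      rw [mem_localBall_iff hτ.le hF] at hy
      right
      -- The local radius at x is at most τ(d + dist x z). As τ < 1/4, the part τ dist x z is
      -- absorbed on the left, which leaves dist x z ≤ d / 2.
      have h1 : infDist x (frontier Ω) ≤ d + dist x z := infDist_le_infDist_add_dist
      have h2 := dist_triangle x y z
      rw [mem_ball] at hyz
      rw [dist_comm x y] at h2
      rw [mem_closedBall]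
      have h3 : dist y x < τ * (d + dist x z) := hy.2.trans_le (by gcongr)
      have h4 : τ * dist x z ≤ 1 / 4 * dist x z := by gcongr
      rw [mul_add] at h3
      linarith

/-! ### Distance to a mean, controlled by the fractional gradient -/

/-- Jensen's inequality for the power function, on a finite measure space. -/
theorem enorm_integral_rpow_le {α : Type*} [MeasurableSpace α] (μ : Measure α)
    {h : α → ℝ} (hh : AEStronglyMeasurable h μ) {p : ℝ} (hp : 1 ≤ p) :
    ‖∫ x, h x ∂μ‖ₑ ^ p ≤ (∫⁻ x, ‖h x‖ₑ ^ p ∂μ) * μ univ ^ (p - 1) := by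
  have hp0 : 0 < p := by linarith
  have h1 : ‖∫ x, h x ∂μ‖ₑ ≤ eLpNorm h 1 μ := by
    rw [eLpNorm_one_eq_lintegral_enorm]
    exact enorm_integral_le_lintegral_enorm _
  have h2 := eLpNorm_le_eLpNorm_mul_rpow_measure_univ (p := 1) (q := ENNReal.ofReal p)
    (by simpa using hp) hh
  rw [eLpNorm_eq_lintegral_rpow_enorm_toReal (p := ENNReal.ofReal p) (by simpa using hp0)
    ENNReal.ofReal_ne_top, ENNReal.toReal_ofReal hp0.le] at h2
  refine (ENNReal.rpow_le_rpow (h1.trans h2) hp0.le).trans (le_of_eq ?_)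
  rw [ENNReal.mul_rpow_of_nonneg _ _ hp0.le, ← ENNReal.rpow_mul, ← ENNReal.rpow_mul,
    one_div_mul_cancel hp0.ne', ENNReal.rpow_one]
  congr 2
  simp only [ENNReal.toReal_one]
  field_simp

theorem enorm_rpow_eq_ofReal_abs_rpow (a : ℝ) {p : ℝ} (hp : 0 ≤ p) :
    ‖a‖ₑ ^ p = ENNReal.ofReal (|a| ^ p) := by
  rw [Real.enorm_eq_ofReal_abs, ENNReal.ofReal_rpow_of_nonneg (abs_nonneg _) hp]

theorem rpow_sub_average_mul_volume_le {n : ℕ} {S : Set (EuclideanSpace ℝ (Fin n))}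
    {u : EuclideanSpace ℝ (Fin n) → ℝ} (hS0 : volume S ≠ 0) (hS : volume S ≠ ⊤)
    (hu : IntegrableOn u S) {p : ℝ} (hp : 1 ≤ p) (a : ℝ) :
    ENNReal.ofReal (|a - ⨍ y in S, u y| ^ p) * volume S ≤
      ∫⁻ y in S, ENNReal.ofReal (|a - u y| ^ p) := by
  have hp0 : 0 < p := by linarith
  have : IsFiniteMeasure (volume.restrict S) := ⟨by simpa using hS.lt_top⟩
  have hV : 0 < (volume S).toReal := ENNReal.toReal_pos hS0 hS
  have hint : ∫ y in S, (a - u y) = (volume S).toReal * (a - ⨍ y in S, u y) := by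
    rw [integral_sub (integrable_const _) hu, setAverage_eq, integral_const]
    simp only [smul_eq_mul, measureReal_def, Measure.restrict_apply_univ]
    field_simp
  have key := enorm_integral_rpow_le (volume.restrict S) (h := fun y => a - u y)
    ((integrable_const a).sub hu).aestronglyMeasurable hp
  rw [hint, enorm_mul, ENNReal.mul_rpow_of_nonneg _ _ hp0.le, Measure.restrict_apply_univ,
    Real.enorm_eq_ofReal hV.le, ENNReal.ofReal_toReal hS] at key
  simp only [enorm_rpow_eq_ofReal_abs_rpow _ hp0.le] at key
  have hVp : volume S ^ p = volume S ^ (p - 1) * volume S := by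
    nth_rewrite 3 [← ENNReal.rpow_one (volume S)]
    rw [← ENNReal.rpow_add _ _ hS0 hS]
    congr 1; ring
  have h0 : volume S ^ (p - 1) ≠ 0 := (ENNReal.rpow_pos (pos_iff_ne_zero.2 hS0) hS).ne'
  have h1 : volume S ^ (p - 1) ≠ ⊤ := ENNReal.rpow_ne_top_of_nonneg (by linarith) hS
  rw [hVp, mul_comm (∫⁻ y in S, _), mul_assoc, ENNReal.mul_le_mul_iff_right h0 h1, mul_comm] at key
  exact key

/-- On S the kernel is at least D^(-(n + pδ)) away from y = x, where the integrand vanishes anyway.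
-/
theorem lintegral_rpow_sub_le_fracGrad {n : ℕ} {Ω S : Set (EuclideanSpace ℝ (Fin n))}
    {u : EuclideanSpace ℝ (Fin n) → ℝ} {p δ τ D : ℝ} (hp : 0 < p) (hδ : 0 ≤ δ)
    {x : EuclideanSpace ℝ (Fin n)} (hS : MeasurableSet S) (hSx : S ⊆ localBall Ω τ x)
    (hD : ∀ y ∈ S, dist x y ≤ D) :
    ∫⁻ y in S, ENNReal.ofReal (|u x - u y| ^ p) ≤
      ENNReal.ofReal (D ^ ((n : ℝ) + p * δ)) * fracGrad Ω p δ τ u x := by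
  unfold fracGrad
  rw [← lintegral_const_mul' _ _ ENNReal.ofReal_ne_top]
  refine le_trans ?_ (lintegral_mono_set hSx)
  refine setLIntegral_mono' hS fun y hy => ?_
  have hD0 : 0 ≤ D := dist_nonneg.trans (hD y hy)
  rw [← ENNReal.ofReal_mul (by positivity)]
  refine ENNReal.ofReal_le_ofReal ?_
  rcases eq_or_ne x y with rfl | hxy
  · simp [Real.zero_rpow hp.ne']
  · have h1 : 0 < dist x y := dist_pos.2 hxy
    rw [← mul_div_assoc, le_div_iff₀ (by positivity), mul_comm]
    gcongr
    exact hD y hy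

/-! ### The cutoff function and its kernel -/

/-- The cutoff function equal to `0` on `B(z, r)` and to `1` off `B(z, 2r)`. -/
noncomputable def cutoff {n : ℕ} (z : EuclideanSpace ℝ (Fin n)) (r : ℝ)
    (x : EuclideanSpace ℝ (Fin n)) : ℝ := max 0 (min 1 (dist x z / r - 1))

theorem continuous_cutoff {n : ℕ} (z : EuclideanSpace ℝ (Fin n)) (r : ℝ) :
    Continuous (cutoff z r) := by
  unfold cutoff; fun_prop

theorem cutoff_nonneg {n : ℕ} (z : EuclideanSpace ℝ (Fin n)) (r : ℝ)
    (x : EuclideanSpace ℝ (Fin n)) : 0 ≤ cutoff z r x := le_max_left _ _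

theorem cutoff_le_one {n : ℕ} (z : EuclideanSpace ℝ (Fin n)) (r : ℝ)
    (x : EuclideanSpace ℝ (Fin n)) : cutoff z r x ≤ 1 := max_le zero_le_one (min_le_left _ _)

theorem cutoff_of_mem_ball {n : ℕ} {z : EuclideanSpace ℝ (Fin n)} {r : ℝ} (hr : 0 < r)
    {x : EuclideanSpace ℝ (Fin n)} (hx : x ∈ ball z r) : cutoff z r x = 0 := by
  rw [mem_ball, ← div_lt_one hr] at hx
  exact max_eq_left ((min_le_right _ _).trans (by linarith))

theorem cutoff_of_notMem_ball {n : ℕ} {z : EuclideanSpace ℝ (Fin n)} {r : ℝ} (hr : 0 < r)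
    {x : EuclideanSpace ℝ (Fin n)} (hx : x ∉ ball z (2 * r)) : cutoff z r x = 1 := by
  rw [mem_ball, not_lt, ← le_div_iff₀ hr] at hx
  rw [cutoff, min_eq_left (by linarith), max_eq_right zero_le_one]

theorem abs_cutoff_sub_le_one {n : ℕ} (z : EuclideanSpace ℝ (Fin n)) (r : ℝ)
    (x y : EuclideanSpace ℝ (Fin n)) : |cutoff z r x - cutoff z r y| ≤ 1 := by
  rw [abs_le]
  constructor <;> linarith [cutoff_nonneg z r x, cutoff_nonneg z r y, cutoff_le_one z r x,
    cutoff_le_one z r y]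

theorem abs_cutoff_sub_le {n : ℕ} {z : EuclideanSpace ℝ (Fin n)} {r : ℝ} (hr : 0 < r)
    (x y : EuclideanSpace ℝ (Fin n)) : |cutoff z r x - cutoff z r y| ≤ min 1 (dist x y / r) := by
  refine le_min (abs_cutoff_sub_le_one z r x y) ?_
  have h1 : |cutoff z r x - cutoff z r y| ≤ |(dist x z / r - 1) - (dist y z / r - 1)| := by
    refine (abs_max_sub_max_le_max _ _ _ _).trans ?_
    refine max_le (by simp) ((abs_min_sub_min_le_max _ _ _ _).trans ?_)
    exact max_le (by simp) le_rfl
  refine h1.trans ?_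
  have h2 : (dist x z / r - 1) - (dist y z / r - 1) = (dist x z - dist y z) / r := by ring
  rw [h2, abs_div, abs_of_pos hr]
  gcongr
  exact abs_dist_sub_le _ _ _

/-- In polar coordinates the integrand is a multiple of t^(p - 1 - pδ) near 0, integrable since δ <
1, and equals t^(-1 - pδ) beyond r, integrable since δ > 0. -/
theorem integrable_truncated_kernel {n : ℕ} (hn : n ≠ 0) {p δ r : ℝ} (hp : 0 < p)
    (hδ : 0 < δ) (hδ1 : δ < 1) (hr : 0 < r) :
    Integrable (fun y : EuclideanSpace ℝ (Fin n) =>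
      (min 1 (‖y‖ / r)) ^ p / ‖y‖ ^ ((n : ℝ) + p * δ)) := by
  have : Nonempty (Fin n) := ⟨⟨0, Nat.pos_of_ne_zero hn⟩⟩
  have hpow : ∀ t : ℝ, 0 < t → t ^ (n - 1) = t ^ ((n : ℝ) - 1) := fun t ht => by
    rw [← Real.rpow_natCast, Nat.cast_sub (Nat.one_le_iff_ne_zero.2 hn), Nat.cast_one]
  refine (integrable_fun_norm_addHaar (volume : Measure (EuclideanSpace ℝ (Fin n)))
    (f := fun t => (min 1 (t / r)) ^ p / t ^ ((n : ℝ) + p * δ))).2 ?_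
  rw [finrank_euclideanSpace_fin, ← Ioc_union_Ioi_eq_Ioi hr.le]
  refine IntegrableOn.union ?_ ?_
  · have h1 : IntegrableOn (fun t : ℝ => (r ^ p)⁻¹ * t ^ (p - 1 - p * δ)) (Ioc 0 r) :=
      ((intervalIntegrable_iff_integrableOn_Ioc_of_le hr.le).1
        (intervalIntegral.intervalIntegrable_rpow' (by nlinarith))).const_mul _
    refine h1.congr_fun (fun t ht => ?_) measurableSet_Ioc
    have ht0 : 0 < t := ht.1
    simp only [smul_eq_mul]
    rw [min_eq_right ((div_le_one hr).2 ht.2), hpow t ht0, Real.div_rpow ht0.le hr.le,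
      show p - 1 - p * δ = ((n : ℝ) - 1) + p - (n + p * δ) by ring,
      Real.rpow_sub ht0, Real.rpow_add ht0]
    field_simp
  · have h1 : IntegrableOn (fun t : ℝ => t ^ (-1 - p * δ)) (Ioi r) :=
      integrableOn_Ioi_rpow_of_lt (by nlinarith) hr
    refine h1.congr_fun (fun t ht => ?_) measurableSet_Ioi
    have ht0 : 0 < t := hr.trans ht
    simp only [smul_eq_mul]
    rw [min_eq_left ((one_le_div hr).2 (le_of_lt ht)), hpow t ht0, Real.one_rpow,
      show -1 - p * δ = ((n : ℝ) - 1) - (n + p * δ) by ring, Real.rpow_sub ht0]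
    field_simp

theorem exists_lintegral_cutoff_kernel_le {n : ℕ} (hn : n ≠ 0) {p δ r : ℝ} (hp : 0 < p)
    (hδ : 0 < δ) (hδ1 : δ < 1) (hr : 0 < r) (z : EuclideanSpace ℝ (Fin n)) :
    ∃ M : ℝ≥0∞, M ≠ ⊤ ∧ ∀ x, ∫⁻ y, ENNReal.ofReal
      (|cutoff z r x - cutoff z r y| ^ p / dist x y ^ ((n : ℝ) + p * δ)) ≤ M := by
  refine ⟨_, (integrable_truncated_kernel hn hp hδ hδ1 hr).lintegral_lt_top.ne, fun x => ?_⟩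
  rw [← lintegral_sub_left_eq_self _ x]
  refine lintegral_mono fun y => ENNReal.ofReal_le_ofReal ?_
  rw [show ‖y‖ = dist x (x - y) by simp]
  gcongr
  exact abs_cutoff_sub_le hr _ _

/-! ### Energy of the cut-off function -/

theorem abs_add_rpow_le (a b : ℝ) {p : ℝ} (hp : 0 < p) :
    |a + b| ^ p ≤ 2 ^ p * (|a| ^ p + |b| ^ p) := by
  have h1 : |a + b| ≤ 2 * max |a| |b| := by
    have := abs_add_le a b
    linarith [le_max_left |a| |b|, le_max_right |a| |b|]
  refine (Real.rpow_le_rpow (abs_nonneg _) h1 hp.le).trans ?_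
  rw [Real.mul_rpow two_pos.le (by positivity)]
  gcongr
  rcases max_choice |a| |b| with h | h <;> rw [h]
  · exact le_add_of_nonneg_right (by positivity)
  · exact le_add_of_nonneg_left (by positivity)

/-- Leibniz splitting with u x - c in the error term. It serves where the gradient at x controls u x
- c, or where the cutoff is constant on the local ball. -/
theorem fracGrad_cutoff_mul_le {n : ℕ} (Ω : Set (EuclideanSpace ℝ (Fin n)))
    (u : EuclideanSpace ℝ (Fin n) → ℝ) {p : ℝ} (hp : 0 < p) (δ τ c r : ℝ)
    (x z : EuclideanSpace ℝ (Fin n)) :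
    fracGrad Ω p δ τ (fun y => cutoff z r y * (u y - c)) x ≤ ENNReal.ofReal (2 ^ p) *
      (fracGrad Ω p δ τ u x + ENNReal.ofReal (|u x - c| ^ p) * ∫⁻ y in localBall Ω τ x,
        ENNReal.ofReal (|cutoff z r x - cutoff z r y| ^ p / dist x y ^ ((n : ℝ) + p * δ))) := by
  have hm : Measurable fun y => ENNReal.ofReal
      (|cutoff z r x - cutoff z r y| ^ p / dist x y ^ ((n : ℝ) + p * δ)) := by
    have := (continuous_cutoff z r).measurable
    fun_prop
  unfold fracGrad
  rw [← lintegral_const_mul' _ _ ENNReal.ofReal_ne_top,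
    ← lintegral_add_right _ (hm.const_mul _), ← lintegral_const_mul' _ _ ENNReal.ofReal_ne_top]
  refine lintegral_mono fun y => ?_
  dsimp only
  rw [← ENNReal.ofReal_mul (by positivity), ← ENNReal.ofReal_add (by positivity) (by positivity),
    ← ENNReal.ofReal_mul (by positivity)]
  refine ENNReal.ofReal_le_ofReal ?_
  rw [← mul_div_assoc, ← add_div, ← mul_div_assoc]
  gcongr
  have h1 : cutoff z r x * (u x - c) - cutoff z r y * (u y - c) =
    cutoff z r y * (u x - u y) + (u x - c) * (cutoff z r x - cutoff z r y) := by ring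
  have h2 : |cutoff z r y * (u x - u y)| ≤ |u x - u y| := by
    rw [abs_mul, abs_of_nonneg (cutoff_nonneg z r y)]
    exact mul_le_of_le_one_left (abs_nonneg _) (cutoff_le_one z r y)
  rw [h1]
  refine (abs_add_rpow_le _ _ hp).trans ?_
  rw [abs_mul (u x - c), Real.mul_rpow (abs_nonneg _) (abs_nonneg _)]
  gcongr

/-- The other Leibniz splitting, with u y - c in the error term, for points whose local ball may
contain only part of B(z, 2r), so that the gradient at x need not control u x - c. The error lives
on y ∈ B(z, 2r), at distance at least r from x. -/
theorem fracGrad_cutoff_mul_le_of_notMem {n : ℕ} {Ω : Set (EuclideanSpace ℝ (Fin n))}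
    (hΩ : IsOpen Ω) {u : EuclideanSpace ℝ (Fin n) → ℝ} (hu : ContinuousOn u Ω) {p δ r : ℝ}
    (hp : 0 < p) (hδ : 0 < δ) (τ c : ℝ) (hr : 0 < r) {x z : EuclideanSpace ℝ (Fin n)}
    (hx : x ∉ ball z (3 * r)) :
    fracGrad Ω p δ τ (fun y => cutoff z r y * (u y - c)) x ≤ ENNReal.ofReal (2 ^ p) *
      (fracGrad Ω p δ τ u x + ENNReal.ofReal ((r ^ ((n : ℝ) + p * δ))⁻¹) *
        ∫⁻ y in ball z (2 * r), ENNReal.ofReal (|u y - c| ^ p)) := by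
  have hx3 : 3 * r ≤ dist x z := by simpa using hx
  have hx1 : cutoff z r x = 1 := cutoff_of_notMem_ball hr fun h => by
    rw [mem_ball] at h; linarith
  set G : EuclideanSpace ℝ (Fin n) → ℝ≥0∞ := (ball z (2 * r)).indicator fun y =>
    ENNReal.ofReal (|u y - c| ^ p)
  have hG : AEMeasurable G (volume.restrict (localBall Ω τ x)) := by
    have h1 : AEMeasurable u (volume.restrict (localBall Ω τ x)) :=
      (hu.aemeasurable hΩ.measurableSet).mono_measure
        (Measure.restrict_mono inter_subset_left le_rfl)
    refine AEMeasurable.indicator ?_ measurableSet_ball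
    fun_prop
  have hle : ∫⁻ y in localBall Ω τ x, G y ≤
      ∫⁻ y in ball z (2 * r), ENNReal.ofReal (|u y - c| ^ p) :=
    (setLIntegral_le_lintegral _ _).trans (lintegral_indicator measurableSet_ball _).le
  refine le_trans ?_ (mul_le_mul_right (add_le_add_right (mul_le_mul_right hle _) _) _)
  unfold fracGrad
  rw [← lintegral_const_mul' _ G ENNReal.ofReal_ne_top,
    ← lintegral_add_right' _ (hG.const_mul _), ← lintegral_const_mul' _ _ ENNReal.ofReal_ne_top]
  refine lintegral_mono fun y => ?_
  dsimp only
  rw [hx1]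
  by_cases hy : y ∈ ball z (2 * r)
  · simp only [G]
    rw [indicator_of_mem hy, ← ENNReal.ofReal_mul (by positivity),
      ← ENNReal.ofReal_add (by positivity) (by positivity), ← ENNReal.ofReal_mul (by positivity)]
    refine ENNReal.ofReal_le_ofReal ?_
    have hd : r ≤ dist x y := by
      have := dist_triangle x y z
      rw [mem_ball] at hy
      linarith
    have h1 : 1 * (u x - c) - cutoff z r y * (u y - c) =
      (u x - u y) + (1 - cutoff z r y) * (u y - c) := by ring
    have h2 : |(1 - cutoff z r y) * (u y - c)| ≤ |u y - c| := by
      rw [abs_mul, abs_of_nonneg (sub_nonneg.2 (cutoff_le_one z r y))]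
      exact mul_le_of_le_one_left (abs_nonneg _) (by linarith [cutoff_nonneg z r y])
    calc _ ≤ (2 ^ p * (|u x - u y| ^ p + |u y - c| ^ p)) / dist x y ^ ((n : ℝ) + p * δ) := by
            rw [h1]
            gcongr
            refine (abs_add_rpow_le _ _ hp).trans ?_
            gcongr
      _ = 2 ^ p * (|u x - u y| ^ p / dist x y ^ ((n : ℝ) + p * δ) +
            (dist x y ^ ((n : ℝ) + p * δ))⁻¹ * |u y - c| ^ p) := by ring
      _ ≤ _ := by gcongr
  · rw [cutoff_of_notMem_ball hr hy]
    simp only [G]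
    rw [indicator_of_notMem hy, mul_zero, add_zero]
    simp only [one_mul, sub_sub_sub_cancel_right]
    refine le_mul_of_one_le_left zero_le ?_
    rw [ENNReal.one_le_ofReal]
    exact Real.one_le_rpow one_le_two hp.le

theorem rpow_sub_average_le_fracGrad {n : ℕ} {Ω S : Set (EuclideanSpace ℝ (Fin n))}
    {u : EuclideanSpace ℝ (Fin n) → ℝ} {p δ τ D : ℝ} (hp : 1 ≤ p) (hδ : 0 ≤ δ)
    {x : EuclideanSpace ℝ (Fin n)} (hSm : MeasurableSet S) (hS0 : volume S ≠ 0)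
    (hS : volume S ≠ ⊤) (hu : IntegrableOn u S) (hSx : S ⊆ localBall Ω τ x)
    (hD : ∀ y ∈ S, dist x y ≤ D) :
    ENNReal.ofReal (|u x - ⨍ y in S, u y| ^ p) ≤
      (volume S)⁻¹ * ENNReal.ofReal (D ^ ((n : ℝ) + p * δ)) * fracGrad Ω p δ τ u x := by
  have h1 := (rpow_sub_average_mul_volume_le hS0 hS hu hp (u x)).trans
    (lintegral_rpow_sub_le_fracGrad (by linarith) hδ hSm hSx hD)
  rw [mul_assoc, mul_comm, ← div_eq_mul_inv, ENNReal.le_div_iff_mul_le (Or.inl hS0) (Or.inl hS)]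
  exact h1

/-- Write S = B(z, 2r) and s = n + pδ. Near z, the gradient at x controls |u x - c|^p and the cutoff
kernel has bounded integral. Far from z with S inside the local ball, that control costs a factor (2
dist x z)^s, which the decay (dist x z / 3)^(-s) of the kernel cancels up to 6^s. If the local ball
meets S otherwise, x lies in K and the second splitting produces the integral over S. If it misses
S, the error vanishes. -/
theorem AnchorBall.exists_fracGrad_cutoff_mul_le {n : ℕ} {Ω : Set (EuclideanSpace ℝ (Fin n))}
    {τ r : ℝ} {z : EuclideanSpace ℝ (Fin n)} {K : Set (EuclideanSpace ℝ (Fin n))}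
    (h : AnchorBall Ω τ z r K) (hΩ : IsOpen Ω) (hn : n ≠ 0) {p δ : ℝ} (hp : 1 ≤ p) (hδ : 0 < δ)
    (hδ1 : δ < 1) :
    ∃ C : ℝ≥0∞, C ≠ ⊤ ∧ ∀ u : EuclideanSpace ℝ (Fin n) → ℝ, ContinuousOn u Ω → ∀ x ∈ Ω,
      fracGrad Ω p δ τ (fun y => cutoff z r y * (u y - ⨍ y in ball z (2 * r), u y)) x ≤
        C * (fracGrad Ω p δ τ u x + K.indicator (fun _ => ∫⁻ y in ball z (2 * r),
          ENNReal.ofReal (|u y - ⨍ y in ball z (2 * r), u y| ^ p)) x) := by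
  have hp0 : 0 < p := by linarith
  have hr := h.pos
  set s : ℝ := (n : ℝ) + p * δ with hs
  have hs0 : 0 < s := by positivity
  set S := ball z (2 * r) with hSdef
  have hS0 : volume S ≠ 0 := (measure_ball_pos _ _ (by positivity)).ne'
  have hS : volume S ≠ ⊤ := measure_ball_lt_top.ne
  obtain ⟨M, hM, hMx⟩ := exists_lintegral_cutoff_kernel_le hn hp0 hδ hδ1 hr z
  set C₁ : ℝ≥0∞ := (volume S)⁻¹ * ENNReal.ofReal ((5 * r) ^ s) * M with hC₁
  set C₂ : ℝ≥0∞ := ENNReal.ofReal (6 ^ s) with hC₂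
  set C₃ : ℝ≥0∞ := ENNReal.ofReal ((r ^ s)⁻¹) with hC₃
  have hC₁t : C₁ ≠ ⊤ := ENNReal.mul_ne_top
    (ENNReal.mul_ne_top (ENNReal.inv_ne_top.2 hS0) ENNReal.ofReal_ne_top) hM
  refine ⟨ENNReal.ofReal (2 ^ p) * (1 + C₁ + C₂ + C₃), ENNReal.mul_ne_top ENNReal.ofReal_ne_top
    (by simp [hC₁t, hC₂, hC₃]), fun u hu x hx => ?_⟩
  set c := ⨍ y in S, u y with hc
  have huS : IntegrableOn u S := ((hu.mono h.subset).integrableOn_compact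
    (isCompact_closedBall _ _)).mono_set (ball_subset_closedBall.trans
      (closedBall_subset_closedBall (by linarith)))
  set I := ∫⁻ y in S, ENNReal.ofReal (|u y - c| ^ p) with hI
  set g := fracGrad Ω p δ τ u x with hg
  have hA := fracGrad_cutoff_mul_le Ω u hp0 δ τ c r x z
  have main : ∀ X : ℝ≥0∞, ∀ C, C ≤ 1 + C₁ + C₂ + C₃ → X ≤ C * g → X ≤
      (1 + C₁ + C₂ + C₃) * (g + K.indicator (fun _ => I) x) := fun X C hC hX =>
    hX.trans (mul_le_mul' hC le_self_add)
  rw [mul_assoc]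
  by_cases hx3 : x ∈ ball z (3 * r)
  · refine hA.trans (mul_le_mul_right (main _ (1 + C₁) ?_ ?_) _)
    · rw [add_assoc (1 + C₁)]; exact le_self_add
    have h1 := rpow_sub_average_le_fracGrad hp hδ.le measurableSet_ball hS0 hS huS (h.near x hx3)
      (D := 5 * r) fun y hy => by
        have := dist_triangle_right x y z
        rw [mem_ball] at hx3 hy
        linarith
    rw [add_mul, one_mul]
    refine add_le_add_right ?_ g
    refine (mul_le_mul' h1 ((setLIntegral_le_lintegral _ _).trans (hMx x))).trans (le_of_eq ?_)
    rw [hC₁]; ring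
  have hX3 : 3 * r ≤ dist x z := by simpa using hx3
  have hX0 : 0 < dist x z := by linarith
  have hx2 : cutoff z r x = 1 := cutoff_of_notMem_ball hr fun h' => by
    rw [mem_ball] at h'; linarith
  by_cases hmeet : (localBall Ω τ x ∩ S).Nonempty
  · rcases h.far x hx hmeet with hsub | hK
    · refine hA.trans (mul_le_mul_right (main _ (1 + C₂) ?_ ?_) _)
      · calc 1 + C₂ ≤ 1 + C₂ + (C₁ + C₃) := le_self_add
          _ = _ := by ring
      have h1 := rpow_sub_average_le_fracGrad hp hδ.le measurableSet_ball hS0 hS huS hsub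
        (D := 2 * dist x z) fun y hy => by
          have := dist_triangle_right x y z
          rw [mem_ball] at hy
          linarith
      have h2 : ∫⁻ y in localBall Ω τ x, ENNReal.ofReal
          (|cutoff z r x - cutoff z r y| ^ p / dist x y ^ s) ≤
          ENNReal.ofReal (((dist x z / 3) ^ s)⁻¹) * volume S := by
        rw [← lintegral_indicator_const measurableSet_ball]
        refine (setLIntegral_le_lintegral _ _).trans (lintegral_mono fun y => ?_)
        by_cases hy : y ∈ S
        · rw [indicator_of_mem hy]
          refine ENNReal.ofReal_le_ofReal ?_
          rw [inv_eq_one_div]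
          -- The point y is within 2r of z, and 2r ≤ (2/3) dist x z.
          have hd : dist x z / 3 ≤ dist x y := by
            have := dist_triangle x y z
            rw [hSdef, mem_ball] at hy
            linarith
          gcongr
          exact Real.rpow_le_one (abs_nonneg _) (abs_cutoff_sub_le_one z r x y) hp0.le
        · rw [indicator_of_notMem hy, hx2, cutoff_of_notMem_ball hr hy]
          simp [Real.zero_rpow hp0.ne']
      rw [add_mul, one_mul]
      refine add_le_add_right ?_ g
      refine (mul_le_mul' h1 h2).trans (le_of_eq ?_)
      have h6 : C₂ = ENNReal.ofReal ((2 * dist x z) ^ s) *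
          ENNReal.ofReal (((dist x z / 3) ^ s)⁻¹) := by
        rw [hC₂, ← ENNReal.ofReal_mul (by positivity), ← div_eq_mul_inv,
          ← Real.div_rpow (by positivity) (by positivity)]
        congr 2
        field_simp
        norm_num
      rw [h6]
      calc _ = ((volume S)⁻¹ * volume S) * (ENNReal.ofReal ((2 * dist x z) ^ s) *
          ENNReal.ofReal (((dist x z / 3) ^ s)⁻¹) * g) := by ring
        _ = _ := by rw [ENNReal.inv_mul_cancel hS0 hS, one_mul]
    · refine (fracGrad_cutoff_mul_le_of_notMem hΩ hu hp0 hδ τ c hr hx3).trans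
        (mul_le_mul_right ?_ _)
      rw [indicator_of_mem hK, mul_add]
      gcongr
      · refine le_mul_of_one_le_left zero_le ?_
        rw [add_assoc, add_assoc]; exact le_self_add
      · exact le_add_self
  · refine hA.trans (mul_le_mul_right (main _ 1 ?_ ?_) _)
    · rw [add_assoc, add_assoc]; exact le_self_add
    have h0 : ∫⁻ y in localBall Ω τ x, ENNReal.ofReal
        (|cutoff z r x - cutoff z r y| ^ p / dist x y ^ s) = 0 := by
      rw [← lintegral_zero (μ := volume.restrict (localBall Ω τ x))]
      refine setLIntegral_congr_fun (measurableSet_localBall hΩ τ x) fun y hy => ?_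
      rw [hx2, cutoff_of_notMem_ball hr fun hyS => hmeet ⟨y, hy, hyS⟩]
      simp [Real.zero_rpow hp0.ne']
    rw [h0, mul_zero, add_zero, one_mul]

/-- Integrating the pointwise bound leaves I ∫_K g with I = ∫_S |u - c|^p. The integral of g is
finite because K is compact in Ω, though g need not be integrable on Ω. On S the gradient at y
controls |u y - c|^p and g is at least m > 0, so I is bounded by the energy of u. -/
theorem AnchorBall.exists_energy_cutoff_mul_le {n : ℕ} {Ω : Set (EuclideanSpace ℝ (Fin n))}
    {τ r : ℝ} {z : EuclideanSpace ℝ (Fin n)} {K : Set (EuclideanSpace ℝ (Fin n))}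
    (h : AnchorBall Ω τ z r K) (hΩ : IsOpen Ω) (hn : n ≠ 0) {p δ : ℝ} (hp : 1 ≤ p) (hδ : 0 < δ)
    (hδ1 : δ < 1) {g : EuclideanSpace ℝ (Fin n) → ℝ} (hg : ContinuousOn g Ω)
    (hg0 : ∀ x ∈ Ω, 0 < g x) :
    ∃ C : ℝ≥0∞, C ≠ ⊤ ∧ ∀ u : EuclideanSpace ℝ (Fin n) → ℝ, ContinuousOn u Ω →
      energy Ω g p δ τ (fun y => cutoff z r y * (u y - ⨍ y in ball z (2 * r), u y)) ≤
        C * energy Ω g p δ τ u := by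
  have hr := h.pos
  have hp0 : 0 < p := by linarith
  obtain ⟨C, hC, hCu⟩ := h.exists_fracGrad_cutoff_mul_le hΩ hn hp hδ hδ1
  set S := ball z (2 * r) with hSdef
  have hS0 : volume S ≠ 0 := (measure_ball_pos _ _ (by positivity)).ne'
  have hS : volume S ≠ ⊤ := measure_ball_lt_top.ne
  have hScb : S ⊆ closedBall z (3 * r) := ball_subset_closedBall.trans
    (closedBall_subset_closedBall (by linarith))
  obtain ⟨x₀, hx₀, hmin⟩ := (isCompact_closedBall z (3 * r)).exists_isMinOn
    ⟨z, mem_closedBall_self (by linarith)⟩ (hg.mono h.subset)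
  set m := g x₀
  have hm : 0 < m := hg0 _ (h.subset hx₀)
  have hgK : ∫⁻ x in K, ENNReal.ofReal (g x) ≠ ⊤ :=
    ((hg.mono h.compact_subset).integrableOn_compact h.compact).lintegral_lt_top.ne
  have hgm : AEMeasurable (fun x => ENNReal.ofReal (g x)) (volume.restrict Ω) :=
    (hg.aemeasurable hΩ.measurableSet).ennreal_ofReal
  set D : ℝ≥0∞ := (volume S)⁻¹ * ENNReal.ofReal ((5 * r) ^ ((n : ℝ) + p * δ)) with hD
  have hDt : D ≠ ⊤ := ENNReal.mul_ne_top (ENNReal.inv_ne_top.2 hS0) ENNReal.ofReal_ne_top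
  refine ⟨C * (1 + D * ENNReal.ofReal m⁻¹ * ∫⁻ x in K, ENNReal.ofReal (g x)),
    ENNReal.mul_ne_top hC (ENNReal.add_ne_top.2 ⟨ENNReal.one_ne_top,
      ENNReal.mul_ne_top (ENNReal.mul_ne_top hDt ENNReal.ofReal_ne_top) hgK⟩), fun u hu => ?_⟩
  set c := ⨍ y in S, u y with hc
  have huS : IntegrableOn u S := ((hu.mono h.subset).integrableOn_compact
    (isCompact_closedBall _ _)).mono_set hScb
  set I := ∫⁻ y in S, ENNReal.ofReal (|u y - c| ^ p) with hI
  have hIle : I ≤ D * ENNReal.ofReal m⁻¹ * energy Ω g p δ τ u := by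
    calc I ≤ ∫⁻ y in S, D * ENNReal.ofReal m⁻¹ *
          (fracGrad Ω p δ τ u y * ENNReal.ofReal (g y)) := by
          refine setLIntegral_mono' measurableSet_ball fun y hy => ?_
          have hy3 : y ∈ ball z (3 * r) := ball_subset_ball (by linarith) hy
          have h1 := rpow_sub_average_le_fracGrad hp hδ.le measurableSet_ball hS0 hS huS
            (h.near y hy3) (D := 5 * r) fun w hw => by
              have := dist_triangle_right y w z
              rw [mem_ball] at hy3 hw
              linarith
          have h2 : 1 ≤ ENNReal.ofReal m⁻¹ * ENNReal.ofReal (g y) := by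
            rw [← ENNReal.ofReal_mul (by positivity), ENNReal.one_le_ofReal,
              ← div_eq_inv_mul, one_le_div hm]
            exact hmin (hScb hy)
          calc _ ≤ D * fracGrad Ω p δ τ u y * 1 := by rw [mul_one]; exact h1
            _ ≤ D * fracGrad Ω p δ τ u y * (ENNReal.ofReal m⁻¹ * ENNReal.ofReal (g y)) := by
              gcongr
            _ = _ := by ring
      _ = D * ENNReal.ofReal m⁻¹ *
          ∫⁻ y in S, fracGrad Ω p δ τ u y * ENNReal.ofReal (g y) :=
          lintegral_const_mul' _ _ (ENNReal.mul_ne_top hDt ENNReal.ofReal_ne_top)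
      _ ≤ _ := by
          gcongr
          exact lintegral_mono_set (hScb.trans h.subset)
  have hKm : MeasurableSet K := h.compact.isClosed.measurableSet
  have hgK' : AEMeasurable (fun x => ENNReal.ofReal (g x)) (volume.restrict K) :=
    hgm.mono_measure (Measure.restrict_mono h.compact_subset le_rfl)
  calc energy Ω g p δ τ (fun y => cutoff z r y * (u y - c))
      ≤ ∫⁻ x in Ω, C * (fracGrad Ω p δ τ u x * ENNReal.ofReal (g x) +
          K.indicator (fun x => I * ENNReal.ofReal (g x)) x) := by
        refine setLIntegral_mono' hΩ.measurableSet fun x hx => ?_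
        refine (mul_le_mul_left (hCu u hu x hx) _).trans (le_of_eq ?_)
        rw [mul_assoc, add_mul]
        by_cases hxK : x ∈ K
        · rw [indicator_of_mem hxK, indicator_of_mem hxK]
        · rw [indicator_of_notMem hxK, indicator_of_notMem hxK, zero_mul]
    _ = C * (energy Ω g p δ τ u +
          ∫⁻ x in Ω, K.indicator (fun x => I * ENNReal.ofReal (g x)) x) := by
        rw [lintegral_const_mul' _ _ hC, lintegral_add_right' _
          ((hgm.const_mul I).indicator hKm)]
        rfl
    _ ≤ C * (energy Ω g p δ τ u + I * ∫⁻ x in K, ENNReal.ofReal (g x)) := by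
        gcongr
        refine (setLIntegral_le_lintegral _ _).trans (le_of_eq ?_)
        rw [lintegral_indicator hKm, lintegral_const_mul'' _ hgK']
    _ ≤ C * (energy Ω g p δ τ u + D * ENNReal.ofReal m⁻¹ * energy Ω g p δ τ u *
          ∫⁻ x in K, ENNReal.ofReal (g x)) := by gcongr
    _ = _ := by ring

/-! ### Gluing two estimates and passing to the mean -/

/-- On T both estimates hold, and μ T ≠ 0 turns this into a bound for c₁ - c₂. On S₁, which avoids
S₂, the second estimate then applies at the cost of that difference. -/
theorem exists_eLpNorm_sub_const_le {α : Type*} [MeasurableSpace α] (μ : Measure α)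
    [IsFiniteMeasure μ] {q : ℝ≥0∞} (hq : 1 ≤ q) (hqt : q ≠ ⊤) {S₁ S₂ T : Set α}
    (hS₁ : MeasurableSet S₁) (h₁₂ : S₁ ⊆ S₂ᶜ) (hT₁ : T ⊆ S₁ᶜ) (hT₂ : T ⊆ S₂ᶜ) (hT : μ T ≠ 0) :
    ∃ C : ℝ≥0∞, C ≠ ⊤ ∧ ∀ (u : α → ℝ), AEStronglyMeasurable u μ → ∀ (c₁ c₂ : ℝ) (a₁ a₂ : ℝ≥0∞),
      eLpNorm (fun x => u x - c₁) q (μ.restrict S₁ᶜ) ≤ a₁ →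
      eLpNorm (fun x => u x - c₂) q (μ.restrict S₂ᶜ) ≤ a₂ →
      eLpNorm (fun x => u x - c₁) q μ ≤ C * (a₁ + a₂) := by
  have hq0 : q ≠ 0 := (zero_lt_one.trans_le hq).ne'
  have hqi : 0 ≤ 1 / q.toReal := by positivity
  set κ := μ T ^ (1 / q.toReal) with hκ
  set N := μ univ ^ (1 / q.toReal) with hN
  have hκ0 : κ ≠ 0 := (ENNReal.rpow_pos (pos_iff_ne_zero.2 hT) (measure_ne_top _ _)).ne'
  have hκt : κ ≠ ⊤ := ENNReal.rpow_ne_top_of_nonneg hqi (measure_ne_top _ _)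
  have hNt : N ≠ ⊤ := ENNReal.rpow_ne_top_of_nonneg hqi (measure_ne_top _ _)
  refine ⟨1 + κ⁻¹ * N, ENNReal.add_ne_top.2 ⟨ENNReal.one_ne_top,
    ENNReal.mul_ne_top (ENNReal.inv_ne_top.2 hκ0) hNt⟩, fun u hu c₁ c₂ a₁ a₂ h₁ h₂ => ?_⟩
  have hsub : ∀ c : ℝ, AEStronglyMeasurable (fun x => u x - c) μ := fun c =>
    hu.sub aestronglyMeasurable_const
  have hcc : ‖c₁ - c₂‖ₑ ≤ κ⁻¹ * (a₁ + a₂) := by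
    have h3 : eLpNorm (fun _ => c₁ - c₂) q (μ.restrict T) ≤ a₂ + a₁ := by
      have h4 : (fun _ : α => c₁ - c₂) = (fun x => u x - c₂) - fun x => u x - c₁ := by
        ext x; simp
      rw [h4]
      refine (eLpNorm_sub_le (hsub c₂).restrict (hsub c₁).restrict hq).trans (add_le_add ?_ ?_)
      · exact (eLpNorm_mono_measure _ (Measure.restrict_mono hT₂ le_rfl)).trans h₂
      · exact (eLpNorm_mono_measure _ (Measure.restrict_mono hT₁ le_rfl)).trans h₁
    rw [eLpNorm_const' _ hq0 hqt, Measure.restrict_apply_univ, add_comm] at h3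
    rw [mul_comm, ← div_eq_mul_inv, ENNReal.le_div_iff_mul_le (Or.inl hκ0) (Or.inl hκt)]
    exact h3
  have hS : eLpNorm (fun x => u x - c₁) q (μ.restrict S₁) ≤ a₂ + ‖c₁ - c₂‖ₑ * N := by
    have h4 : (fun x => u x - c₁) = (fun x => u x - c₂) - fun _ : α => c₁ - c₂ := by
      ext x; simp
    rw [h4]
    refine (eLpNorm_sub_le (hsub c₂).restrict aestronglyMeasurable_const hq).trans
      (add_le_add ?_ ?_)
    · exact (eLpNorm_mono_measure _ (Measure.restrict_mono h₁₂ le_rfl)).trans h₂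
    · rw [eLpNorm_const' _ hq0 hqt, Measure.restrict_apply_univ]
      rw [hN]
      gcongr
      exact subset_univ _
  calc eLpNorm (fun x => u x - c₁) q μ
      = eLpNorm (S₁ᶜ.indicator (fun x => u x - c₁) + S₁.indicator fun x => u x - c₁) q μ := by
        rw [indicator_compl_add_self]
    _ ≤ eLpNorm (fun x => u x - c₁) q (μ.restrict S₁ᶜ) +
          eLpNorm (fun x => u x - c₁) q (μ.restrict S₁) := by
        rw [← eLpNorm_indicator_eq_eLpNorm_restrict hS₁.compl,
          ← eLpNorm_indicator_eq_eLpNorm_restrict hS₁]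
        exact eLpNorm_add_le ((hsub c₁).indicator hS₁.compl) ((hsub c₁).indicator hS₁) hq
    _ ≤ a₁ + (a₂ + κ⁻¹ * (a₁ + a₂) * N) := by
        refine add_le_add h₁ (hS.trans ?_)
        gcongr
    _ = _ := by ring

/-- The mean differs from c by the mean of u - c, which Hölder's inequality bounds by the L^q norm
of u - c. -/
theorem exists_eLpNorm_sub_average_le {α : Type*} [MeasurableSpace α] (μ : Measure α)
    [IsFiniteMeasure μ] (hμ : μ ≠ 0) {q : ℝ≥0∞} (hq : 1 ≤ q) (hqt : q ≠ ⊤) :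
    ∃ C : ℝ≥0∞, C ≠ ⊤ ∧ ∀ (u : α → ℝ), Integrable u μ → ∀ c : ℝ,
      eLpNorm (fun x => u x - ⨍ y, u y ∂μ) q μ ≤ C * eLpNorm (fun x => u x - c) q μ := by
  have hq0 : q ≠ 0 := (zero_lt_one.trans_le hq).ne'
  have hqi : 0 ≤ 1 / q.toReal := by positivity
  have hq1 : 1 / q.toReal ≤ 1 := by
    have : 1 ≤ q.toReal := by
      rw [← ENNReal.toReal_one]
      exact ENNReal.toReal_mono hqt hq
    exact (div_le_one (by linarith)).2 this
  have : NeZero μ := ⟨hμ⟩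
  set N := μ univ with hN
  have hN0 : N ≠ 0 := by simpa [hN] using hμ
  have hNt : N ≠ ⊤ := measure_ne_top _ _
  set A := N ^ (1 / (1 : ℝ≥0∞).toReal - 1 / q.toReal) with hA
  have hAt : A ≠ ⊤ := ENNReal.rpow_ne_top_of_nonneg (by simpa using hq1) hNt
  have hBt : N ^ (1 / q.toReal) ≠ ⊤ := ENNReal.rpow_ne_top_of_nonneg hqi hNt
  refine ⟨1 + N⁻¹ * A * N ^ (1 / q.toReal), ENNReal.add_ne_top.2 ⟨ENNReal.one_ne_top,
    ENNReal.mul_ne_top (ENNReal.mul_ne_top (ENNReal.inv_ne_top.2 hN0) hAt) hBt⟩,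
    fun u hu c => ?_⟩
  have hsub : AEStronglyMeasurable (fun x => u x - c) μ :=
    hu.aestronglyMeasurable.sub aestronglyMeasurable_const
  set m := ⨍ y, u y ∂μ with hm
  have hmc : ‖m - c‖ₑ ≤ N⁻¹ * A * eLpNorm (fun x => u x - c) q μ := by
    have h1 : ∫ x, (u x - c) ∂μ = N.toReal * (m - c) := by
      have hN' : N.toReal ≠ 0 := (ENNReal.toReal_pos hN0 hNt).ne'
      rw [integral_sub hu (integrable_const _), integral_const, hm, average_eq]
      simp only [smul_eq_mul, measureReal_def, ← hN]
      field_simp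
    have h2 : ‖∫ x, (u x - c) ∂μ‖ₑ ≤ eLpNorm (fun x => u x - c) q μ * A := by
      refine le_trans ?_ (eLpNorm_le_eLpNorm_mul_rpow_measure_univ hq hsub)
      rw [eLpNorm_one_eq_lintegral_enorm]
      exact enorm_integral_le_lintegral_enorm _
    rw [h1, enorm_mul, Real.enorm_eq_ofReal ENNReal.toReal_nonneg, ENNReal.ofReal_toReal hNt,
      mul_comm] at h2
    rw [mul_assoc, mul_comm, ← div_eq_mul_inv, ENNReal.le_div_iff_mul_le (Or.inl hN0)
      (Or.inl hNt), mul_comm A]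
    exact h2
  have h4 : (fun x => u x - m) = (fun x => u x - c) - fun _ : α => m - c := by
    ext x; simp
  rw [h4]
  refine (eLpNorm_sub_le hsub aestronglyMeasurable_const hq).trans ?_
  rw [eLpNorm_const' _ hq0 hqt, add_mul, one_mul, ← hN]
  refine add_le_add le_rfl ?_
  calc _ ≤ N⁻¹ * A * eLpNorm (fun x => u x - c) q μ * N ^ (1 / q.toReal) := by gcongr
    _ = _ := by ring

theorem eLpNorm_ofReal_eq {α : Type*} [MeasurableSpace α] (μ : Measure α) (h : α → ℝ) {q : ℝ}
    (hq : 0 < q) : eLpNorm h (ENNReal.ofReal q) μ =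
      (∫⁻ x, ENNReal.ofReal (|h x| ^ q) ∂μ) ^ (1 / q) := by
  rw [eLpNorm_eq_lintegral_rpow_enorm_toReal (by simpa using hq) ENNReal.ofReal_ne_top,
    ENNReal.toReal_ofReal hq.le]
  simp only [enorm_rpow_eq_ofReal_abs_rpow _ hq.le]

/-- The constant c is the mean of u over the doubled ball; off that ball the cutoff is 1, so the
Sobolev inequality for the cut-off function speaks of u - c itself. -/
theorem AnchorBall.exists_eLpNorm_le {n : ℕ} {Ω : Set (EuclideanSpace ℝ (Fin n))}
    {τ r : ℝ} {z : EuclideanSpace ℝ (Fin n)} {K : Set (EuclideanSpace ℝ (Fin n))}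
    (h : AnchorBall Ω τ z r K) (hΩ : IsOpen Ω) (hn : n ≠ 0) {p q δ : ℝ} (hp : 1 ≤ p)
    (hpq : p ≤ q) (hδ : 0 < δ) (hδ1 : δ < 1) {f g : EuclideanSpace ℝ (Fin n) → ℝ}
    (hg : ContinuousOn g Ω) (hg0 : ∀ x ∈ Ω, 0 < g x) (hcap : CapacityEstimate Ω f g p q δ τ) :
    ∃ C : ℝ≥0∞, C ≠ ⊤ ∧ ∀ u : EuclideanSpace ℝ (Fin n) → ℝ, ContinuousOn u Ω → ∃ c : ℝ,
      eLpNorm (fun x => u x - c) (ENNReal.ofReal q)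
        ((weightMeasure Ω f).restrict (ball z (2 * r))ᶜ) ≤
          C * (energy Ω g p δ τ u) ^ (1 / p) := by
  have hp0 : 0 < p := by linarith
  have hq0 : 0 < q := by linarith
  obtain ⟨C₁, -, hC₁⟩ := hcap z r h.pos h.wellInside
  obtain ⟨C₂, hC₂t, hC₂⟩ := h.exists_energy_cutoff_mul_le hΩ hn hp hδ hδ1 hg hg0
  refine ⟨(ENNReal.ofReal (4 ^ p) * ENNReal.ofReal C₁ * C₂) ^ (1 / p),
    ENNReal.rpow_ne_top_of_nonneg (by positivity) (ENNReal.mul_ne_top (ENNReal.mul_ne_top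
      ENNReal.ofReal_ne_top ENNReal.ofReal_ne_top) hC₂t),
    fun u hu => ⟨⨍ y in ball z (2 * r), u y, ?_⟩⟩
  set c := ⨍ y in ball z (2 * r), u y
  have hv := lintegral_rpow_le_of_capacityEstimate (v := fun y => cutoff z r y * (u y - c))
    hn hΩ hp hpq hC₁ ((continuous_cutoff z r).continuousOn.mul (hu.sub continuousOn_const))
    fun x hx => by rw [cutoff_of_mem_ball h.pos hx, zero_mul]
  rw [eLpNorm_ofReal_eq _ _ hq0, ← ENNReal.mul_rpow_of_nonneg _ _ (by positivity)]
  calc _ ≤ ((ENNReal.ofReal (4 ^ p) * ENNReal.ofReal C₁ *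
        (C₂ * energy Ω g p δ τ u)) ^ (q / p)) ^ (1 / q) := by
        gcongr
        refine le_trans ?_ (hv.trans ?_)
        · rw [← lintegral_indicator measurableSet_ball.compl]
          refine lintegral_mono (indicator_le fun x hx => ?_)
          rw [cutoff_of_notMem_ball h.pos hx, one_mul]
        · gcongr
          exact hC₂ u hu
    _ = _ := by
        rw [← ENNReal.rpow_mul, ← mul_assoc]
        congr 1
        field_simp

/-! ### Translation between `weightMeasure` and integrals over Ω -/

theorem weightMeasure_ne_zero_of_ball {n : ℕ} {Ω : Set (EuclideanSpace ℝ (Fin n))}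
    (hΩ : IsOpen Ω) {f : EuclideanSpace ℝ (Fin n) → ℝ} (hf : ContinuousOn f Ω)
    (hf0 : ∀ x ∈ Ω, 0 < f x) {z : EuclideanSpace ℝ (Fin n)} {r : ℝ} (hr : 0 < r)
    (hzr : ball z r ⊆ Ω) : weightMeasure Ω f (ball z r) ≠ 0 := by
  intro h
  rw [weightMeasure, withDensity_apply_eq_zero'
    (hf.aemeasurable hΩ.measurableSet).ennreal_ofReal, Measure.restrict_apply' hΩ.measurableSet]
    at h
  refine (measure_ball_pos volume z hr).ne' (measure_mono_null (fun x hx => ?_) h)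
  exact ⟨⟨by simpa using hf0 x (hzr hx), hx⟩, hzr hx⟩

theorem weightMeasure_integrable_iff {n : ℕ} {Ω : Set (EuclideanSpace ℝ (Fin n))}
    (hΩ : IsOpen Ω) {f : EuclideanSpace ℝ (Fin n) → ℝ} (hf : ContinuousOn f Ω)
    (hf0 : ∀ x ∈ Ω, 0 < f x) (u : EuclideanSpace ℝ (Fin n) → ℝ) :
    Integrable u (weightMeasure Ω f) ↔ IntegrableOn (fun x => u x * f x) Ω := by
  rw [weightMeasure, integrable_withDensity_iff_integrable_smul₀'
    (hf.aemeasurable hΩ.measurableSet).ennreal_ofReal (by simp)]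
  refine integrable_congr ?_
  filter_upwards [ae_restrict_mem hΩ.measurableSet] with x hx
  rw [ENNReal.toReal_ofReal (hf0 x hx).le, smul_eq_mul, mul_comm]

theorem integral_weightMeasure {n : ℕ} {Ω : Set (EuclideanSpace ℝ (Fin n))}
    (hΩ : IsOpen Ω) {f : EuclideanSpace ℝ (Fin n) → ℝ} (hf : ContinuousOn f Ω)
    (hf0 : ∀ x ∈ Ω, 0 < f x) (u : EuclideanSpace ℝ (Fin n) → ℝ) :
    ∫ x, u x ∂weightMeasure Ω f = ∫ x in Ω, u x * f x := by
  rw [weightMeasure, integral_withDensity_eq_integral_toReal_smul₀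
    (hf.aemeasurable hΩ.measurableSet).ennreal_ofReal (by simp)]
  refine integral_congr_ae ?_
  filter_upwards [ae_restrict_mem hΩ.measurableSet] with x hx
  rw [ENNReal.toReal_ofReal (hf0 x hx).le, smul_eq_mul, mul_comm]

theorem weightedAverage_eq_average {n : ℕ} {Ω : Set (EuclideanSpace ℝ (Fin n))}
    (hΩ : IsOpen Ω) {f : EuclideanSpace ℝ (Fin n) → ℝ} (hf : ContinuousOn f Ω)
    (hf0 : ∀ x ∈ Ω, 0 < f x) (u : EuclideanSpace ℝ (Fin n) → ℝ) :
    weightedAverage Ω f u = ⨍ x, u x ∂weightMeasure Ω f := by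
  have h1 : (weightMeasure Ω f).real univ = ∫ x in Ω, f x := by
    have := integral_weightMeasure hΩ hf hf0 fun _ => 1
    simpa using this
  rw [average_eq, integral_weightMeasure hΩ hf hf0, h1, weightedAverage, smul_eq_mul,
    div_eq_inv_mul]

theorem lintegral_weightMeasure {n : ℕ} {Ω : Set (EuclideanSpace ℝ (Fin n))}
    (hΩ : IsOpen Ω) {f : EuclideanSpace ℝ (Fin n) → ℝ} (hf : ContinuousOn f Ω)
    (h : EuclideanSpace ℝ (Fin n) → ℝ) (h0 : ∀ x, 0 ≤ h x) :
    ∫⁻ x, ENNReal.ofReal (h x) ∂weightMeasure Ω f = ∫⁻ x in Ω, ENNReal.ofReal (h x * f x) := by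
  rw [weightMeasure, lintegral_withDensity_eq_lintegral_mul_non_measurable₀ _
    (hf.aemeasurable hΩ.measurableSet).ennreal_ofReal (by simp)]
  refine lintegral_congr fun x => ?_
  rw [Pi.mul_apply, mul_comm, ENNReal.ofReal_mul (h0 x)]

end FracSP

/-! ### Assembly -/

theorem theorem1p1 {n : ℕ} (hn : 2 ≤ n) (Ω : Set (EuclideanSpace ℝ (Fin n))) (hΩ : IsOpen Ω) :
    ∃ τ₀ : ℝ, 0 < τ₀ ∧
      ∀ (f g : EuclideanSpace ℝ (Fin n) → ℝ),
        ContinuousOn f Ω → (∀ x ∈ Ω, 0 < f x) →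
        ContinuousOn g Ω → (∀ x ∈ Ω, 0 < g x) →
        IntegrableOn f Ω →
      ∀ (p q δ : ℝ), 1 ≤ p → p ≤ q → 0 < δ → δ < 1 →
      ∀ (τ : ℝ), 0 < τ → τ < τ₀ →
        FracSP.CapacityEstimate Ω f g p q δ τ →
        ∃ C : ℝ, 0 < C ∧
          ∀ (u : EuclideanSpace ℝ (Fin n) → ℝ), ContinuousOn u Ω →
            (FracSP.energy Ω g p δ τ u < ⊤ → IntegrableOn (fun x => u x * f x) Ω) ∧
            (∫⁻ x in Ω, ENNReal.ofReal (|u x - FracSP.weightedAverage Ω f u| ^ q * f x)) ^ (1 / q) ≤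
              ENNReal.ofReal C * (FracSP.energy Ω g p δ τ u) ^ (1 / p) := by
  refine ⟨1 / 4, by norm_num, fun f g hf hf0 hg hg0 hfi p q δ hp hpq hδ hδ1 τ hτ hτ4 hcap => ?_⟩
  have hn0 : n ≠ 0 := by omega
  have hp0 : 0 < p := by linarith
  have hq0 : 0 < q := by linarith
  rcases Ω.eq_empty_or_nonempty with hΩe | ⟨z₀, hz₀⟩
  · refine ⟨1, one_pos, fun u _ => ⟨fun _ => by simp [hΩe], ?_⟩⟩
    simp [hΩe, hq0]
  have : Nonempty (Fin n) := ⟨⟨0, by omega⟩⟩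
  obtain ⟨R, hR, hRΩ⟩ := Metric.isOpen_iff.1 hΩ z₀ hz₀
  -- The centres z₀ ± w are R apart and R / 2 from z₀. With r ≤ R / 8 the doubles have radius at
  -- most R / 4, so they are disjoint from each other and from B(z₀, R / 4), on which the two
  -- constants are compared.
  obtain ⟨w, hw⟩ := exists_norm_eq (EuclideanSpace ℝ (Fin n)) (c := R / 2) (by positivity)
  have hd₁ : dist (z₀ + w) z₀ = R / 2 := by simp [hw]
  have hd₂ : dist (z₀ - w) z₀ = R / 2 := by simp [hw]
  have hd₁₂ : dist (z₀ + w) (z₀ - w) = R := by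
    rw [dist_eq_norm, add_sub_sub_cancel, ← two_smul ℝ w, norm_smul, hw]
    norm_num
    ring
  obtain ⟨r₁, hr₁, H₁⟩ := FracSP.exists_anchorBall hΩ hτ hτ4
    (hRΩ (Metric.mem_ball.2 (by linarith : dist (z₀ + w) z₀ < R)))
  obtain ⟨r₂, hr₂, H₂⟩ := FracSP.exists_anchorBall hΩ hτ hτ4
    (hRΩ (Metric.mem_ball.2 (by linarith : dist (z₀ - w) z₀ < R)))
  obtain ⟨r, hr, hr1, hr2, hrR⟩ : ∃ r > 0, r ≤ r₁ ∧ r ≤ r₂ ∧ r ≤ R / 8 :=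
    ⟨min r₁ (min r₂ (R / 8)), by positivity, min_le_left _ _,
      (min_le_right _ _).trans (min_le_left _ _), (min_le_right _ _).trans (min_le_right _ _)⟩
  obtain ⟨K₁, hK₁⟩ := H₁ r hr hr1
  obtain ⟨K₂, hK₂⟩ := H₂ r hr hr2
  obtain ⟨C₁, hC₁t, hC₁⟩ := hK₁.exists_eLpNorm_le hΩ hn0 hp hpq hδ hδ1 hg hg0 hcap
  obtain ⟨C₂, hC₂t, hC₂⟩ := hK₂.exists_eLpNorm_le hΩ hn0 hp hpq hδ hδ1 hg hg0 hcap
  set ν := FracSP.weightMeasure Ω f with hν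
  have hνfin : IsFiniteMeasure ν := isFiniteMeasure_withDensity_ofReal hfi.2
  have hνT : ν (Metric.ball z₀ (R / 4)) ≠ 0 :=
    FracSP.weightMeasure_ne_zero_of_ball hΩ hf hf0 (by positivity)
      ((Metric.ball_subset_ball (by linarith)).trans hRΩ)
  have hν0 : ν ≠ 0 := fun h => hνT (by simp [h])
  have hq1 : 1 ≤ ENNReal.ofReal q := by
    rw [ENNReal.one_le_ofReal]; linarith
  obtain ⟨C₃, hC₃t, hC₃⟩ := FracSP.exists_eLpNorm_sub_const_le ν hq1 ENNReal.ofReal_ne_top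
    (S₁ := Metric.ball (z₀ + w) (2 * r)) (S₂ := Metric.ball (z₀ - w) (2 * r))
    measurableSet_ball (Metric.ball_disjoint_ball (by linarith)).subset_compl_right
    (Metric.ball_disjoint_ball (by rw [dist_comm]; linarith)).subset_compl_right
    (Metric.ball_disjoint_ball (by rw [dist_comm]; linarith)).subset_compl_right hνT
  obtain ⟨C₄, hC₄t, hC₄⟩ := FracSP.exists_eLpNorm_sub_average_le ν hν0 hq1 ENNReal.ofReal_ne_top
  set C := C₄ * (C₃ * (C₁ + C₂)) with hC
  have hCt : C ≠ ⊤ := ENNReal.mul_ne_top hC₄t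
    (ENNReal.mul_ne_top hC₃t (ENNReal.add_ne_top.2 ⟨hC₁t, hC₂t⟩))
  refine ⟨C.toReal + 1, by positivity, fun u hu => ?_⟩
  have hum : AEStronglyMeasurable u ν :=
    (hu.aestronglyMeasurable hΩ.measurableSet).mono_ac (withDensity_absolutelyContinuous _ _)
  obtain ⟨c₁, hc₁⟩ := hC₁ u hu
  obtain ⟨c₂, hc₂⟩ := hC₂ u hu
  have hc := hC₃ u hum c₁ c₂ _ _ hc₁ hc₂
  rw [← add_mul, ← mul_assoc] at hc
  have hint : FracSP.energy Ω g p δ τ u < ⊤ → Integrable u ν := fun hE => by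
    have h1 : MemLp (fun x => u x - c₁) (ENNReal.ofReal q) ν :=
      ⟨hum.sub aestronglyMeasurable_const, hc.trans_lt (ENNReal.mul_lt_top
        (ENNReal.mul_lt_top hC₃t.lt_top (ENNReal.add_lt_top.2 ⟨hC₁t.lt_top, hC₂t.lt_top⟩))
        (ENNReal.rpow_lt_top_of_nonneg (by positivity) hE.ne))⟩
    refine ((h1.integrable hq1).add (integrable_const c₁)).congr (ae_of_all _ fun x => ?_)
    simp
  refine ⟨fun hE => (FracSP.weightMeasure_integrable_iff hΩ hf hf0 u).1 (hint hE), ?_⟩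
  -- With infinite energy u f need not be integrable and the average may be a default value, but the
  -- right side is ⊤ because `C.toReal + 1` is positive.
  rcases eq_or_ne (FracSP.energy Ω g p δ τ u) ⊤ with hE | hE
  · rw [hE, ENNReal.top_rpow_of_pos (by positivity),
      ENNReal.mul_top (by rw [Ne, ENNReal.ofReal_eq_zero, not_le]; positivity)]
    exact le_top
  · rw [FracSP.weightedAverage_eq_average hΩ hf hf0,
      ← FracSP.lintegral_weightMeasure hΩ hf _ fun x => by positivity,
      ← FracSP.eLpNorm_ofReal_eq _ _ hq0]
    refine (hC₄ u (hint hE.lt_top) c₁).trans ((mul_le_mul_right hc _).trans ?_)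
    rw [← mul_assoc]
    gcongr
    rw [← hC, ENNReal.le_ofReal_iff_toReal_le hCt (by positivity)]
    linarith
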